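/- Let $M$ be a smooth manifold (finite-dimensional, Hausdorff, paracompact, without boundary) and let $c$ be a smooth Haefliger cocycle of codimension $q$ on $M$: an open cover $\{U_\alpha\}$ of $M$, smooth maps $f_\alpha:U_\alpha\to\mathbb R^q$, and, for each $x\in U_\alpha\cap U_\beta$, a local diffeomorphism $h^x_{\alpha\beta}$ of $\mathbb R^q$ defined near $f_\beta(x)$, such that $(y,s)\mapsto h^y_{\alpha\beta}(s)$ is smooth near $(x,f_\beta(x))$, $f_\alpha=h^x_{\alpha\beta}\circ f_\beta$ near $x$, and $h^x_{\alpha\beta}\circ h^x_{\beta\delta}=h^x_{\alpha\delta}$ as germs at $f_\delta(x)$ for $x\in U_\alpha\cap U_\beta\cap U_\delta$. For $U\subseteq M$ open let $\mathcal D(U)$ be the set of smooth vector fields $X$ on $U$ with $(f_\alpha^*dx^i)(X)=0$ on $U\cap U_\alpha$ for all $\alpha$ and all $i=1,\dots,q$. For $x\in M$ let $\Delta_x\subseteq T_xM$ be the subspace spanned by the values at $x$ of the vector fields in $\mathcal D$ defined near $x$. Then: 1. $\mathcal D$ is a subsheaf of $C^\infty$-modules of the sheaf of smooth vector fields on $M$,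 and it is involutive: $[X,Y]\in\mathcal D(U)$ for all $X,Y\in\mathcal D(U)$. 2. $\mathcal D$ depends only on the Haefliger structure defined by $c$: if $c'$ is a smooth Haefliger cocycle such that $c$ and $c'$ are both restrictions (as cocycles of germs) of one smooth Haefliger cocycle over the union of their covers, then $c'$ defines the same sheaf $\mathcal D$. 3. $\Delta$ is invariant under the local flows of $\mathcal D$: if $X\in\mathcal D(U)$ and $\Phi$ is a local flow of $X$ in $U$, then $d\Phi_t(\Delta_y)=\Delta_{\Phi_t(y)}$ whenever $\Phi_t(y)$ is defined. 4. $\Delta$ is integrable, and so defines a Stefan-Sussmann singular foliation. Here an integral submanifold of $\Delta$ is a connected, paracompact, Hausdorff smooth manifold $\Sigma$ with an injective immersion $\iota:\Sigma\to M$ (not necessarily a homeomorphism onto its image) such that $d\iota(T_p\Sigma)=\Delta_{\iota(p)}$ for all $p\in\Sigma$; it is contained in another one if $\iota$ factors through the latter's immersion by a smooth map, and it is maximal if every integral submanifold that contains it is also contained in it. Precisely: through each point of $M$ there is an integral submanifold of $\Delta$; through each point there is a maximal one, and any two maximal ones whose images meet are diffeomorphic over $M$; and the images of the maximal integral submanifolds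 form a partition of $M$. -/

import Mathlib

open Set Filter Topology TopologicalSpace
open scoped Manifold ContDiff

universe u v w

/-! ### Smooth Haefliger cocycles -/

/-- A smooth Haefliger cocycle of codimension `q` on the `n`-manifold `M`: an open cover `U a` of
`M`, smooth Haefliger charts `f a : U a → ℝ^q`, and for all `x ∈ U a ∩ U b` a local diffeomorphism
`h a b x` of `ℝ^q` near `f b x`, depending smoothly on `x`, such that `f a = h a b x ∘ f b` near
`x` and `h a b x ∘ h b d x = h a d x` as germs at `f d x`.
Charts and transition functions are total functions; the values of `f a` outside `U a` are
irrelevant, and only the germs of the `h a b x` at `f b x` with `x ∈ U a ∩ U b` enter (for the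
smooth dependence on `x`: the germ of `(y, s) ↦ h a b y s` at `(x, f b x)`). -/
structure HaefligerCocycle (n q : ℕ) (M : Type u) [TopologicalSpace M]
    [ChartedSpace (EuclideanSpace ℝ (Fin n)) M] (ι : Type v) where
  U : ι → Opens M
  cover : ∀ x : M, ∃ a, x ∈ U a
  f : ι → M → EuclideanSpace ℝ (Fin q)
  smooth_f : ∀ a, ContMDiffOn (𝓡 n) (𝓡 q) ∞ (f a) (U a)
  h : ι → ι → M → EuclideanSpace ℝ (Fin q) → EuclideanSpace ℝ (Fin q)
  localDiffeo_h : ∀ a b x, x ∈ U a → x ∈ U b →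
    IsLocalDiffeomorphAt (𝓡 q) (𝓡 q) ∞ (h a b x) (f b x)
  smooth_h : ∀ a b x, x ∈ U a → x ∈ U b →
    ∀ᶠ p in 𝓝 (x, f b x), ContMDiffAt ((𝓡 n).prod (𝓡 q)) (𝓡 q) ∞
      (fun p : M × EuclideanSpace ℝ (Fin q) => h a b p.1 p.2) p
  compat : ∀ a b x, x ∈ U a → x ∈ U b → ∀ᶠ y in 𝓝 x, f a y = h a b x (f b y)
  cocycle : ∀ a b d x, x ∈ U a → x ∈ U b → x ∈ U d →
    ∀ᶠ s in 𝓝 (f d x), h a b x (h b d x s) = h a d x s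

/-! ### Vector fields, tangent subsheaves, distributions -/

section Tangent

variable (n : ℕ) (M : Type u) [TopologicalSpace M] [ChartedSpace (EuclideanSpace ℝ (Fin n)) M]

/-- A (rough) vector field on `M`. Vector fields on an open set `U` are represented by vector
fields on `M` of which only the values on `U` matter. -/
abbrev RoughVectorField := (x : M) → TangentSpace (𝓡 n) x

/-- A distribution: a linear subspace of each tangent space, of possibly varying dimension. -/
abbrev TangentDistribution := (x : M) → Submodule ℝ (TangentSpace (𝓡 n) x)

variable {n M} [IsManifold (𝓡 n) ∞ M]

/-- `X` is a smooth vector field on the open set `U`. -/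
def IsSmoothVectorFieldOn (U : Opens M) (X : RoughVectorField n M) : Prop :=
  ContMDiffOn (𝓡 n) (𝓡 n).tangent ∞
    (fun x => (⟨x, X x⟩ : TangentBundle (𝓡 n) M)) (U : Set M)

/-- `D`, assigning to each open `U` a set of vector fields on `U`, is a subsheaf of
`C^∞`-modules of the sheaf of smooth vector fields of `M`. -/
structure IsTangentSubsheaf (D : Opens M → Set (RoughVectorField n M)) : Prop where
  smooth : ∀ U X, X ∈ D U → IsSmoothVectorFieldOn U X
  /-- only the values on `U` matter -/
  congr : ∀ U X Y, X ∈ D U → (∀ x ∈ U, Y x = X x) → Y ∈ D U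
  zero_mem : ∀ U, (fun _ => 0) ∈ D U
  add_mem : ∀ U X Y, X ∈ D U → Y ∈ D U → (fun x => X x + Y x) ∈ D U
  smul_mem : ∀ U X (g : M → ℝ), X ∈ D U → ContMDiffOn (𝓡 n) 𝓘(ℝ, ℝ) ∞ g (U : Set M) →
    (fun x => g x • X x) ∈ D U
  restrict : ∀ U V : Opens M, V ≤ U → D U ⊆ D V
  /-- sections that agree on overlaps glue; with `congr`, the compatible family may be taken to
  consist of restrictions of one rough vector field -/
  glue : ∀ (U : Opens M) X, (∀ x ∈ U, ∃ V : Opens M, x ∈ V ∧ V ≤ U ∧ X ∈ D V) → X ∈ D U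

/-- Closed under the local application of Lie brackets. -/
def IsInvolutiveSheaf (D : Opens M → Set (RoughVectorField n M)) : Prop :=
  ∀ U X Y, X ∈ D U → Y ∈ D U → VectorField.mlieBracket (𝓡 n) X Y ∈ D U

/-- The distribution spanned by `D`: at `x`, the span of the values at `x` of the sections of `D`
that are defined near `x`. -/
noncomputable def spannedDistribution (D : Opens M → Set (RoughVectorField n M)) : TangentDistribution n M :=
  fun x => Submodule.span ℝ {v | ∃ U : Opens M, x ∈ U ∧ ∃ X ∈ D U, X x = v}

/-- `Φ : W → U`, `(t, y) ↦ Φ_t(y)`, is a local flow of the vector field `X` on `U`: `W` is open in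
`ℝ × M`, contains with `(t, y)` the segment from `(0, y)` to `(t, y)`, and `Φ` is smooth on `W`
with `Φ_0(y) = y` and `d/dt Φ_t(y) = X(Φ_t(y))`. -/
structure IsLocalFlow (U : Opens M) (X : RoughVectorField n M) (W : Set (ℝ × M))
    (Φ : ℝ × M → M) : Prop where
  isOpen : IsOpen W
  segment : ∀ t y, (t, y) ∈ W → ∀ s ∈ uIcc 0 t, (s, y) ∈ W
  smooth : ContMDiffOn (𝓘(ℝ, ℝ).prod (𝓡 n)) (𝓡 n) ∞ Φ W
  mapsTo : ∀ p ∈ W, Φ p ∈ U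
  zero : ∀ y, ((0 : ℝ), y) ∈ W → Φ (0, y) = y
  integral : ∀ y, IsMIntegralCurveOn (I := 𝓡 n) (fun t => Φ (t, y)) X {t | (t, y) ∈ W}

/-- `Δ` is invariant under the local flows of the local vector fields in `D`:
`dΦ_t (Δ_y) = Δ_{Φ_t(y)}` wherever `Φ_t(y)` is defined. -/
def IsFlowInvariant (D : Opens M → Set (RoughVectorField n M))
    (Δ : TangentDistribution n M) : Prop :=
  ∀ U X, X ∈ D U → ∀ W Φ, IsLocalFlow U X W Φ → ∀ t y, (t, y) ∈ W →
    (Δ y).map (mfderiv (𝓡 n) (𝓡 n) (fun z => Φ (t, z)) y).toLinearMap = Δ (Φ (t, y))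

/-- An integral submanifold of `Δ`: a connected, paracompact Hausdorff smooth manifold together
with an injective immersion into `M` (not necessarily a homeomorphism onto its image) whose tangent
space at each point is the value of `Δ` there. -/
structure IntegralSubmanifold (Δ : TangentDistribution n M) where
  carrier : Type u
  dim : ℕ
  [topologicalSpace : TopologicalSpace carrier]
  [chartedSpace : ChartedSpace (EuclideanSpace ℝ (Fin dim)) carrier]
  [isManifold : IsManifold (𝓡 dim) ∞ carrier]
  [t2Space : T2Space carrier]
  [paracompactSpace : ParacompactSpace carrier]
  [connectedSpace : ConnectedSpace carrier]
  incl : carrier → M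
  smooth_incl : ContMDiff (𝓡 dim) (𝓡 n) ∞ incl
  injective_incl : Function.Injective incl
  immersion_incl : ∀ p, Function.Injective (mfderiv (𝓡 dim) (𝓡 n) incl p)
  tangent_incl : ∀ p, (mfderiv (𝓡 dim) (𝓡 n) incl p).toLinearMap.range = Δ (incl p)

namespace IntegralSubmanifold

attribute [instance] topologicalSpace chartedSpace isManifold t2Space paracompactSpace
  connectedSpace

variable {Δ : TangentDistribution n M}

/-- `S` is contained in `T`, as an integral submanifold: the inclusion of `S` into `M` factors
through that of `T` by a smooth map. -/
def ContainedIn (S T : IntegralSubmanifold Δ) : Prop :=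
  ∃ g : S.carrier → T.carrier, ContMDiff (𝓡 S.dim) (𝓡 T.dim) ∞ g ∧ T.incl ∘ g = S.incl

/-- `S` is not contained in a strictly larger integral submanifold. -/
def IsMaximal (S : IntegralSubmanifold Δ) : Prop :=
  ∀ T : IntegralSubmanifold Δ, S.ContainedIn T → T.ContainedIn S

end IntegralSubmanifold

/-- `Δ` is integrable: it has an integral submanifold through each point. -/
def IsIntegrableDistribution (Δ : TangentDistribution n M) : Prop :=
  ∀ x : M, ∃ S : IntegralSubmanifold Δ, x ∈ range S.incl

/-- `Δ` is tangent to a partition of `M` into leaves: through each point there is a maximal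
integral submanifold, it is unique (up to a diffeomorphism over `M`), and the maximal
integral submanifolds partition `M`. -/
structure DefinesSingularFoliation (Δ : TangentDistribution n M) : Prop where
  exists_maximal : ∀ x : M, ∃ L : IntegralSubmanifold Δ, L.IsMaximal ∧ x ∈ range L.incl
  unique_maximal : ∀ L L' : IntegralSubmanifold Δ, L.IsMaximal → L'.IsMaximal →
    (range L.incl ∩ range L'.incl).Nonempty →
      ∃ e : L.carrier ≃ L'.carrier, ContMDiff (𝓡 L.dim) (𝓡 L'.dim) ∞ e ∧
        ContMDiff (𝓡 L'.dim) (𝓡 L.dim) ∞ e.symm ∧ L'.incl ∘ e = L.incl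
  partition : Setoid.IsPartition
    {A : Set M | ∃ L : IntegralSubmanifold Δ, L.IsMaximal ∧ range L.incl = A}

end Tangent

/-! ### The sheaf and the distribution of a Haefliger cocycle -/

namespace HaefligerCocycle

variable {n q : ℕ} {M : Type u} [TopologicalSpace M] [ChartedSpace (EuclideanSpace ℝ (Fin n)) M]
  [IsManifold (𝓡 n) ∞ M] {ι : Type v} {ι' : Type w}

/-- Two Haefliger cocycles are equivalent if both are restrictions (as cocycles of germs) of one
Haefliger cocycle over the union of the two covers. -/
def Equivalent (c : HaefligerCocycle n q M ι) (c' : HaefligerCocycle n q M ι') : Prop :=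
  ∃ d : HaefligerCocycle n q M (ι ⊕ ι'),
    (∀ a, d.U (.inl a) = c.U a ∧ EqOn (d.f (.inl a)) (c.f a) (c.U a)) ∧
    (∀ a b x, x ∈ c.U a → x ∈ c.U b →
      d.h (.inl a) (.inl b) x =ᶠ[𝓝 (c.f b x)] c.h a b x) ∧
    (∀ a, d.U (.inr a) = c'.U a ∧ EqOn (d.f (.inr a)) (c'.f a) (c'.U a)) ∧
    (∀ a b x, x ∈ c'.U a → x ∈ c'.U b →
      d.h (.inr a) (.inr b) x =ᶠ[𝓝 (c'.f b x)] c'.h a b x)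

/-- The value at `y ∈ U a` of the 1-form `f_a^* dx^i`. -/
noncomputable def pullbackForm (c : HaefligerCocycle n q M ι) (a : ι) (i : Fin q) (y : M) :
    TangentSpace (𝓡 n) y →L[ℝ] ℝ :=
  (EuclideanSpace.proj i : EuclideanSpace ℝ (Fin q) →L[ℝ] ℝ).comp
    (mfderiv (𝓡 n) (𝓡 q) (c.f a) y)

/-- The sheaf of smooth vector fields annihilating the forms `f_a^* dx^i`. -/
def sheaf (c : HaefligerCocycle n q M ι) (U : Opens M) : Set (RoughVectorField n M) :=
  {X | IsSmoothVectorFieldOn U X ∧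
    ∀ a i, ∀ y ∈ U, y ∈ c.U a → c.pullbackForm a i y (X y) = 0}

/-- The distribution associated to a Haefliger cocycle. -/
noncomputable def distribution (c : HaefligerCocycle n q M ι) : TangentDistribution n M :=
  spannedDistribution c.sheaf

end HaefligerCocycle

/-! On an overlap `f_a = h ∘ f_b` near each point, so `df_a` and `df_b` have the same kernel. There
is thus one field of subspaces `K` (`kernel`), in general of varying rank, and the sheaf consists of
the smooth fields with values in `K`. The subsheaf axioms become pointwise statements, involutivity
is the symmetry of second derivatives, and equivalent cocycles have the same `K` because the common
cocycle compares their charts. The values at `x` of germs of such fields already form a subspace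
(`distribution_eq`), so `Δ` is natural under local diffeomorphisms that preserve `K` near a point
(`mem_generatedDistribution_iff`).

Flows: a section `X` kills `df_b`, so `f_b ∘ Φ_s` is locally constant in `s`, and hence so is the
condition `dΦ_s v ∈ K`. The kernel of `dΦ_s` is locally constant in `s` by the variational equation,
and it is trivial at `s = 0`. So `Φ_t` is a local diffeomorphism that preserves `K`, and naturality
gives the invariance of `Δ`.

Integrability: choose sections `X_1, …, X_k` whose values at `x` form a basis of `Δ_x`. The time-one
maps of `∑ t_i X_i`, started on a slice transverse to `Δ_x`, give coordinates `(t, w)` in which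
`f_a` depends on `w` only (`exists_straightening`). In them `K`, and with it `Δ`, is invariant under
translations in `t` and contains the `t`-directions. So the rank of `Δ` depends on `w` only, and
where it equals `k`, `Δ` is exactly the `t`-factor (`exists_foliatedChart`). The smooth dependence
of the time-one maps on `(t, w)` comes from the inverse function theorem in the Banach space of
curves.

Leaves: the slices `w = const` (plaques) are charts for a manifold structure on the set of points of
rank `k`, because `w` is locally constant along every map tangent to `Δ` (`eventually_snd_eq`). The
leaves are its connected components. Every integral submanifold that meets a leaf maps smoothly into
it (`containedIn_leaf`), which gives maximality, uniqueness and the partition. Paracompactness of a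
leaf is a countability argument: a plaque is second countable, so it meets only countably many
plaques of countably many charts. -/

/-! ### Composition operators on spaces of continuous maps -/

section CompositionOperator

variable {K : Type*} [TopologicalSpace K] [CompactSpace K]
  {E F : Type u} [NormedAddCommGroup E] [NormedSpace ℝ E] [NormedAddCommGroup F] [NormedSpace ℝ F]

variable (K E F) in
/-- Pointwise application, as a continuous bilinear map. -/
noncomputable def ContinuousMap.applyBilin : C(K, E →L[ℝ] F) →L[ℝ] C(K, E) →L[ℝ] C(K, F) :=
  LinearMap.mkContinuous₂
    (LinearMap.mk₂ ℝ (fun (A : C(K, E →L[ℝ] F)) (h : C(K, E)) => (⟨fun k => A k (h k), by fun_prop⟩ : C(K, F)))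
      (fun _ _ _ => by ext; simp) (fun _ _ _ => by ext; simp)
      (fun _ _ _ => by ext; simp) (fun _ _ _ => by ext; simp)) 1 (fun A h => by
    rw [one_mul, ContinuousMap.norm_le _ (by positivity)]
    intro k
    exact ((A k).le_opNorm _).trans
      (mul_le_mul (A.norm_coe_le_norm k) (h.norm_coe_le_norm k) (norm_nonneg _) (norm_nonneg A)))

@[simp] lemma ContinuousMap.applyBilin_apply (A : C(K, E →L[ℝ] F)) (h : C(K, E)) (k : K) :
    ContinuousMap.applyBilin K E F A h k = A k (h k) := rfl

/-- The mean value inequality on the segment from `γ k` to `γ k + h k` bounds the remainder,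
provided that `Dv` varies by at most `ε` there, uniformly in `k`. The uniformity is the continuity
of `γ ↦ Dv ∘ γ` in the sup norm. -/
lemma ContinuousMap.hasFDerivAt_comp_left {v : E → F} (hv : ContDiff ℝ 1 v) (γ : C(K, E)) :
    HasFDerivAt (fun γ : C(K, E) => (⟨v, hv.continuous⟩ : C(E, F)).comp γ)
      (ContinuousMap.applyBilin K E F
        ((⟨fderiv ℝ v, hv.continuous_fderiv one_ne_zero⟩ : C(E, E →L[ℝ] F)).comp γ)) γ := by
  set D : C(E, E →L[ℝ] F) := ⟨fderiv ℝ v, hv.continuous_fderiv one_ne_zero⟩ with hD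
  rw [hasFDerivAt_iff_isLittleO_nhds_zero, Asymptotics.isLittleO_iff]
  intro ε hε
  have hc : Continuous (fun γ : C(K, E) => D.comp γ) := D.continuous_postcomp
  have h0 : {γ' : C(K, E) | dist (D.comp γ') (D.comp γ) < ε} ∈ 𝓝 γ :=
    hc.continuousAt.preimage_mem_nhds (Metric.ball_mem_nhds (D.comp γ) hε)
  obtain ⟨δ, hδ, hball⟩ := Metric.mem_nhds_iff.1 h0
  filter_upwards [Metric.ball_mem_nhds (0 : C(K, E)) hδ] with h hh
  have hh' : ‖h‖ < δ := by simpa using hh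
  rw [ContinuousMap.norm_le _ (by positivity)]
  intro k
  have key : ∀ y ∈ segment ℝ (γ k) (γ k + h k), ‖fderiv ℝ v y - fderiv ℝ v (γ k)‖ ≤ ε := by
    intro y hy
    rw [segment_eq_image'] at hy
    obtain ⟨θ, hθ, rfl⟩ := hy
    -- The point `γ k + θ h k` is a value of the curve `γ + θ h`, which is as close to `γ` as `γ +
    -- h` is.
    have h1 : dist (γ + θ • h) γ < δ := by
      rw [dist_eq_norm, add_sub_cancel_left, norm_smul, Real.norm_of_nonneg hθ.1]
      exact (mul_le_of_le_one_left (norm_nonneg _) hθ.2).trans_lt hh'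
    have h2 := (ContinuousMap.dist_apply_le_dist (f := D.comp (γ + θ • h)) (g := D.comp γ) k).trans
      (hball h1).le
    rw [dist_eq_norm] at h2
    simpa [hD] using h2
  have := (convex_segment (𝕜 := ℝ) (γ k) (γ k + h k)).norm_image_sub_le_of_norm_fderiv_le'
    (f := v) (φ := fderiv ℝ v (γ k)) (C := ε)
    (fun y _ => (hv.differentiable one_ne_zero).differentiableAt) key (left_mem_segment ℝ _ _)
    (right_mem_segment ℝ _ _)
  rw [add_sub_cancel_left] at this
  refine le_trans (le_of_eq ?_) (this.trans
    (mul_le_mul_of_nonneg_left (h.norm_coe_le_norm k) hε.le))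
  simp [hD]

/-- The derivative is a continuous linear function of composition with `fderiv ℝ v`, an operator of
the same type with target `E →L[ℝ] F`. The induction therefore has to run over all `F` and `v`, and
`E` and `F` share a universe. -/
lemma ContinuousMap.contDiff_nat_comp_left (m : ℕ) : ∀ {F : Type u} [NormedAddCommGroup F]
    [NormedSpace ℝ F] {v : E → F} (hv : ContDiff ℝ ∞ v),
    ContDiff ℝ m (fun γ : C(K, E) => (⟨v, hv.continuous⟩ : C(E, F)).comp γ) := by
  induction m with
  | zero =>
    intro F _ _ v hv
    exact contDiff_zero.2 (ContinuousMap.continuous_postcomp _)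
  | succ m ih =>
    intro F _ _ v hv
    have h1 : ContDiff ℝ 1 v := hv.of_le (by exact_mod_cast le_top)
    have h2 : ContDiff ℝ ∞ (fderiv ℝ v) := (contDiff_infty_iff_fderiv.1 hv).2
    push_cast
    refine contDiff_succ_iff_hasFDerivAt.2 ⟨_, ?_, fun γ =>
      ContinuousMap.hasFDerivAt_comp_left h1 γ⟩
    exact (ContinuousMap.applyBilin K E F).contDiff.comp (ih h2)

/-- Post-composition with a smooth map is smooth on spaces of continuous maps. -/
theorem ContinuousMap.contDiff_comp_left {v : E → F} (hv : ContDiff ℝ ∞ v) :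
    ContDiff ℝ ∞ (fun γ : C(K, E) => (⟨v, hv.continuous⟩ : C(E, F)).comp γ) :=
  contDiff_infty.2 fun m => ContinuousMap.contDiff_nat_comp_left m hv

end CompositionOperator

/-! ### Inverse function theorem and cut-offs -/

section Inverse

variable {E F : Type*} [NormedAddCommGroup E] [NormedSpace ℝ E] [NormedAddCommGroup F]
  [NormedSpace ℝ F]

/-- The inverse function theorem, with an inverse that is smooth on the whole target and not only at
the image of `a`. -/
theorem ContDiffOn.exists_openPartialHomeomorph [CompleteSpace E] {f : E → F} {O : Set E}
    (hO : IsOpen O) (hf : ContDiffOn ℝ ∞ f O) {a : E} (ha : a ∈ O) (f' : E ≃L[ℝ] F)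
    (hf' : HasFDerivAt f (f' : E →L[ℝ] F) a) :
    ∃ e : OpenPartialHomeomorph E F, ⇑e = f ∧ a ∈ e.source ∧ e.source ⊆ O ∧
      ContDiffOn ℝ ∞ e.symm e.target := by
  have hfa : ContDiffAt ℝ ∞ f a := hf.contDiffAt (hO.mem_nhds ha)
  set e₀ := hfa.toOpenPartialHomeomorph f hf' (by simp) with he₀
  -- At every point of `S` the derivative is invertible, so the inverse is smooth at its image. `S`
  -- is open since invertible operators form an open set.
  set S : Set E := {x ∈ O | fderiv ℝ f x ∈ range ((↑) : (E ≃L[ℝ] F) → E →L[ℝ] F)} with hS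
  have hSo : IsOpen S := by
    refine (hf.continuousOn_fderiv_of_isOpen hO (by simp)).isOpen_inter_preimage hO
      ContinuousLinearEquiv.isOpen
  refine ⟨e₀.restrOpen S hSo, rfl, ?_, ?_, ?_⟩
  · exact ⟨hfa.mem_toOpenPartialHomeomorph_source hf' (by simp), ha, f', hf'.fderiv.symm⟩
  · exact fun x hx => hx.2.1
  · intro y hy
    have hx := (e₀.restrOpen S hSo).map_target hy
    obtain ⟨L, hL⟩ := hx.2.2
    refine ContDiffAt.contDiffWithinAt ?_
    refine (e₀.restrOpen S hSo).contDiffAt_symm (f₀' := L) hy ?_ ?_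
    · rw [hL]
      exact ((hf.contDiffAt (hO.mem_nhds hx.2.1)).differentiableAt (by simp)).hasFDerivAt
    · exact hf.contDiffAt (hO.mem_nhds hx.2.1)

lemma ContDiffOn.exists_contDiff_eventuallyEq [FiniteDimensional ℝ E] {f : E → F} {O : Set E}
    {a : E} (hO : O ∈ 𝓝 a) (hf : ContDiffOn ℝ ∞ f O) :
    ∃ g : E → F, ContDiff ℝ ∞ g ∧ g =ᶠ[𝓝 a] f := by
  obtain ⟨r, hr, hrO⟩ := Metric.mem_nhds_iff.1 hO
  let b : ContDiffBump a := ⟨r / 3, r / 2, by positivity, by linarith⟩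
  refine ⟨fun x => b x • f x, ?_, ?_⟩
  · rw [contDiff_iff_contDiffAt]
    intro x
    by_cases hx : x ∈ Metric.ball a r
    · exact b.contDiff.contDiffAt.smul
        (hf.contDiffAt (mem_of_superset (Metric.isOpen_ball.mem_nhds hx) hrO))
    · have : (fun x => b x • f x) =ᶠ[𝓝 x] fun _ => 0 := by
        have hx' : x ∈ (Metric.closedBall a (r / 2))ᶜ := by
          simp only [Metric.mem_ball, not_lt, mem_compl_iff, Metric.mem_closedBall, not_le] at hx ⊢
          linarith
        filter_upwards [Metric.isClosed_closedBall.isOpen_compl.mem_nhds hx'] with y hy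
        have : b y = 0 := b.zero_of_le_dist (by
          simp only [mem_compl_iff, Metric.mem_closedBall, not_le] at hy
          exact hy.le)
        simp [this]
      exact contDiffAt_const.congr_of_eventuallyEq this
  · filter_upwards [b.eventuallyEq_one] with x hx
    rw [hx]; simp

end Inverse

/-! ### Time-one maps of families of vector fields, and straightening -/

section Straightening

variable {E : Type*} [NormedAddCommGroup E] [NormedSpace ℝ E]

lemma ContinuousMap.continuous_intervalIntegral_projIcc (γ : C(unitInterval, E)) :
    Continuous (fun s : unitInterval => ∫ τ in (0 : ℝ)..s, γ (projIcc 0 1 zero_le_one τ)) :=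
  (intervalIntegral.continuous_primitive
    (fun _ _ => (γ.continuous.comp continuous_projIcc).intervalIntegrable _ _) 0).comp
    continuous_subtype_val

/-- The operator sending a curve on the unit interval to its primitive vanishing at `0`. -/
noncomputable def ContinuousMap.primitive (E : Type*) [NormedAddCommGroup E] [NormedSpace ℝ E] :
    C(unitInterval, E) →L[ℝ] C(unitInterval, E) :=
  LinearMap.mkContinuous
    { toFun := fun γ => ⟨_, γ.continuous_intervalIntegral_projIcc⟩
      map_add' := fun γ γ' => by
        ext s
        exact intervalIntegral.integral_add
          ((γ.continuous.comp continuous_projIcc).intervalIntegrable _ _)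
          ((γ'.continuous.comp continuous_projIcc).intervalIntegrable _ _)
      map_smul' := fun c γ => by
        ext s
        exact intervalIntegral.integral_smul c _ } 1 (fun γ => by
    rw [one_mul, ContinuousMap.norm_le _ (norm_nonneg _)]
    intro s
    refine (intervalIntegral.norm_integral_le_of_norm_le_const
      (fun τ _ => γ.norm_coe_le_norm _)).trans ?_
    rw [sub_zero, abs_of_nonneg s.2.1]
    exact mul_le_of_le_one_right (norm_nonneg _) s.2.2)

lemma ContinuousMap.primitive_apply (γ : C(unitInterval, E)) (s : unitInterval) :
    ContinuousMap.primitive E γ s = ∫ τ in (0 : ℝ)..s, γ (projIcc 0 1 zero_le_one τ) := rfl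

variable [CompleteSpace E] {k : ℕ}

lemma ContinuousMap.primitive_const_one (a : E) :
    ContinuousMap.primitive E (ContinuousMap.const unitInterval a) 1 = a := by
  simp [ContinuousMap.primitive_apply]

/-- Solutions `γ` of `γ' = ∑ i, t i • X i γ`, `γ 0 = x`, on the unit interval depend smoothly on
`(t, x)` near `(0, x₀)`. -/
theorem exists_smooth_integral_family (X : Fin k → E → E) (hX : ∀ i, ContDiff ℝ ∞ (X i))
    (x₀ : E) : ∃ Γ : EuclideanSpace ℝ (Fin k) × E → C(unitInterval, E),
      Γ (0, x₀) = ContinuousMap.const _ x₀ ∧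
      (∀ᶠ p in 𝓝 ((0 : EuclideanSpace ℝ (Fin k)), x₀), ContDiffAt ℝ ∞ Γ p) ∧
      (∀ᶠ p in 𝓝 ((0 : EuclideanSpace ℝ (Fin k)), x₀), ∀ s : unitInterval,
        Γ p s = p.2 + ∫ τ in (0 : ℝ)..s,
          ∑ i, p.1 i • X i (Γ p (projIcc 0 1 zero_le_one τ))) ∧
      ∃ D : EuclideanSpace ℝ (Fin k) × E →L[ℝ] C(unitInterval, E),
        HasFDerivAt Γ D (0, x₀) ∧ ∀ p, D p 1 = p.2 + ∑ i, p.1 i • X i x₀ := by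
  let P := EuclideanSpace ℝ (Fin k)
  let N : Fin k → C(unitInterval, E) → C(unitInterval, E) := fun i γ => (⟨X i, (hX i).continuous⟩ : C(E, E)).comp γ
  have hN : ∀ i, ContDiff ℝ ∞ (N i) := fun i => ContinuousMap.contDiff_comp_left (hX i)
  let c : E →L[ℝ] C(unitInterval, E) := ContinuousLinearMap.const ℝ _
  let c₀ : C(unitInterval, E) := c x₀
  let B : (P × E) × C(unitInterval, E) → C(unitInterval, E) := fun p => ∑ i, p.1.1 i • N i p.2
  have hB : ContDiff ℝ ∞ B := by
    refine ContDiff.sum fun i _ => ContDiff.smul (f := fun p : (P × E) × C(unitInterval, E) =>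
      p.1.1 i) ?_ ((hN i).comp contDiff_snd)
    exact (EuclideanSpace.proj i : P →L[ℝ] ℝ).contDiff.comp (contDiff_fst.comp contDiff_fst)
  -- The integral equation with parameters `p` says that the second component of `G (p, γ)`
  -- vanishes. Solutions are thus read off from a local inverse of `G` at `(p, 0)`.
  let G : (P × E) × C(unitInterval, E) → (P × E) × C(unitInterval, E) :=
    fun p => (p.1, p.2 - c p.1.2 - ContinuousMap.primitive E (B p))
  have hG : ContDiff ℝ ∞ G := by
    refine contDiff_fst.prodMk ((contDiff_snd.sub ?_).sub ?_)
    · exact c.contDiff.comp (contDiff_snd.comp contDiff_fst)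
    · exact (ContinuousMap.primitive E).contDiff.comp hB
  -- `B` is linear in `t`, so at `t = 0` only its `t`-derivative survives.
  let B' : P × E →L[ℝ] C(unitInterval, E) := ∑ i, (((EuclideanSpace.proj i : P →L[ℝ] ℝ).comp
    (ContinuousLinearMap.fst ℝ P E)).smulRight (N i c₀))
  have hB' : HasFDerivAt B (B'.comp (ContinuousLinearMap.fst ℝ (P × E) C(unitInterval, E))) ((0, x₀), c₀) := by
    have h1 : ∀ i, HasFDerivAt (fun p : (P × E) × C(unitInterval, E) => p.1.1 i • N i p.2)
        ((((EuclideanSpace.proj i : P →L[ℝ] ℝ).comp (ContinuousLinearMap.fst ℝ P E)).smulRight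
          (N i c₀)).comp (ContinuousLinearMap.fst ℝ (P × E) C(unitInterval, E))) ((0, x₀), c₀) := by
      intro i
      have ha : HasFDerivAt (fun p : (P × E) × C(unitInterval, E) => p.1.1 i)
          (((EuclideanSpace.proj i : P →L[ℝ] ℝ).comp (ContinuousLinearMap.fst ℝ P E)).comp
            (ContinuousLinearMap.fst ℝ (P × E) C(unitInterval, E))) ((0, x₀), c₀) :=
        (((EuclideanSpace.proj i : P →L[ℝ] ℝ).comp (ContinuousLinearMap.fst ℝ P E)).comp
            (ContinuousLinearMap.fst ℝ (P × E) C(unitInterval, E))).hasFDerivAt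
      have hb : HasFDerivAt (fun p : (P × E) × C(unitInterval, E) => N i p.2)
          ((fderiv ℝ (N i) c₀).comp (ContinuousLinearMap.snd ℝ (P × E) C(unitInterval, E))) ((0, x₀), c₀) :=
        HasFDerivAt.comp (x := ((0, x₀), c₀)) (g := N i)
          (((hN i).differentiable (by simp)) c₀).hasFDerivAt hasFDerivAt_snd
      refine (ha.smul hb).congr_fderiv ?_
      ext p <;> simp
    refine (HasFDerivAt.fun_sum fun i _ => h1 i).congr_fderiv ?_
    ext p <;> simp [B']
  let A : P × E →L[ℝ] C(unitInterval, E) := c.comp (ContinuousLinearMap.snd ℝ P E) +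
    (ContinuousMap.primitive E).comp B'
  -- The derivative of `G` at the base point is the shear `(p, γ) ↦ (p, γ - A p)`, which is
  -- invertible without any contraction estimate.
  let G' : ((P × E) × C(unitInterval, E)) ≃L[ℝ] (P × E) × C(unitInterval, E) := ContinuousLinearEquiv.equivOfInverse
    ((ContinuousLinearMap.fst ℝ (P × E) C(unitInterval, E)).prod
      (ContinuousLinearMap.snd ℝ (P × E) C(unitInterval, E) - A.comp (ContinuousLinearMap.fst ℝ (P × E) C(unitInterval, E))))
    ((ContinuousLinearMap.fst ℝ (P × E) C(unitInterval, E)).prod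
      (ContinuousLinearMap.snd ℝ (P × E) C(unitInterval, E) + A.comp (ContinuousLinearMap.fst ℝ (P × E) C(unitInterval, E))))
    (fun p => Prod.ext rfl (sub_add_cancel _ _)) (fun p => Prod.ext rfl (add_sub_cancel_right _ _))
  have hG' : HasFDerivAt G (G' : ((P × E) × C(unitInterval, E)) →L[ℝ] (P × E) × C(unitInterval, E)) ((0, x₀), c₀) := by
    have h1 : HasFDerivAt (fun p : (P × E) × C(unitInterval, E) => c p.1.2)
        ((c.comp (ContinuousLinearMap.snd ℝ P E)).comp (ContinuousLinearMap.fst ℝ (P × E) C(unitInterval, E)))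
        ((0, x₀), c₀) :=
      ((c.comp (ContinuousLinearMap.snd ℝ P E)).comp
        (ContinuousLinearMap.fst ℝ (P × E) C(unitInterval, E))).hasFDerivAt
    have h2 := (ContinuousMap.primitive E).hasFDerivAt.comp ((0, x₀), c₀) hB'
    refine (hasFDerivAt_fst.prodMk ((hasFDerivAt_snd.sub h1).sub h2)).congr_fderiv ?_
    refine ContinuousLinearMap.ext fun p => Prod.ext rfl ?_
    exact sub_sub _ _ _
  obtain ⟨e, he, hmem, -, hsm⟩ := (hG.contDiffOn (s := univ)).exists_openPartialHomeomorph
    isOpen_univ (mem_univ ((0, x₀), c₀)) G' hG'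
  have he0 : G ((0, x₀), c₀) = ((0, x₀), 0) := by
    refine Prod.ext rfl ?_
    simp [G, B, c₀]
  have ht : (((0 : P), x₀), (0 : C(unitInterval, E))) ∈ e.target := by
    rw [← he0, ← he]; exact e.map_source hmem
  let j : P × E → (P × E) × C(unitInterval, E) := fun p => (p, 0)
  have hj : ContDiff ℝ ∞ j := contDiff_id.prodMk contDiff_const
  have hev : ∀ᶠ p in 𝓝 ((0 : P), x₀), j p ∈ e.target :=
    hj.continuous.continuousAt.preimage_mem_nhds (e.open_target.mem_nhds ht)
  have hsymm : e.symm ((0, x₀), 0) = ((0, x₀), c₀) := by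
    rw [← he0, ← he]; exact e.left_inv hmem
  refine ⟨fun p => (e.symm (j p)).2, ?_, ?_, ?_, A, ?_, ?_⟩
  · change (e.symm ((0, x₀), 0)).2 = _
    rw [hsymm]; rfl
  · filter_upwards [hev] with p hp
    exact contDiffAt_snd.comp p ((hsm.contDiffAt (e.open_target.mem_nhds hp)).comp p hj.contDiffAt)
  · filter_upwards [hev] with p hp s
    have h1 : G (e.symm (j p)) = j p := by rw [← he]; exact e.right_inv hp
    have h2 : (e.symm (j p)).1 = p := congrArg Prod.fst h1
    have h3 : (e.symm (j p)).2 - c (e.symm (j p)).1.2 -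
      ContinuousMap.primitive E (B (e.symm (j p))) = 0 := congrArg Prod.snd h1
    have h4 := DFunLike.congr_fun h3 s
    simp only [ContinuousMap.sub_apply, ContinuousMap.zero_apply, h2, sub_sub, sub_eq_zero] at h4
    have h5 : (e.symm (j p)).2 s = p.2 + ∫ τ in (0 : ℝ)..s,
        B (e.symm (j p)) (projIcc 0 1 zero_le_one τ) := h4
    refine h5.trans (congrArg (p.2 + ·) (intervalIntegral.integral_congr fun τ _ => ?_))
    simp [B, N, h2, ContinuousMap.sum_apply]
  · have h1 : HasFDerivAt e.symm (G'.symm : (P × E) × C(unitInterval, E) →L[ℝ] (P × E) × C(unitInterval, E)) (j (0, x₀)) := by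
      refine e.hasFDerivAt_symm ht ?_
      rw [he]; change HasFDerivAt G _ (e.symm ((0, x₀), 0)); rw [hsymm]; exact hG'
    have h2 : HasFDerivAt j (ContinuousLinearMap.inl ℝ (P × E) C(unitInterval, E)) ((0 : P), x₀) :=
      hasFDerivAt_prodMk_left _ _
    have h3 := hasFDerivAt_snd.comp ((0 : P), x₀) (h1.comp ((0 : P), x₀) h2)
    refine h3.congr_fderiv ?_
    refine ContinuousLinearMap.ext fun p => ?_
    change 0 + A p = A p
    rw [zero_add]
  · intro p
    have : B' p = ContinuousMap.const _ (∑ i, p.1 i • X i x₀) := by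
      ext s
      simp [B', N, c₀, c, ContinuousMap.sum_apply]
    change c p.2 1 + ContinuousMap.primitive E (B' p) 1 = _
    rw [this, ContinuousMap.primitive_const_one]
    rfl

/-- First integrals are constant along solutions of the integral equation. -/
lemma first_integral_eq_of_integral_eq {G : Type*} [NormedAddCommGroup G]
    [NormedSpace ℝ G]
    {g : E → G} {O : Set E} (hO : IsOpen O) (hg : DifferentiableOn ℝ g O) {V : E → E}
    (hV : Continuous V) (hgV : ∀ x ∈ O, fderiv ℝ g x (V x) = 0) (γ : C(unitInterval, E))
    (hγO : ∀ s, γ s ∈ O) (x : E)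
    (hγ : ∀ s : unitInterval, γ s = x + ∫ τ in (0 : ℝ)..s, V (γ (projIcc 0 1 zero_le_one τ))) :
    g (γ 1) = g x := by
  -- The right-hand side of the integral equation extends `γ` to `ℝ`, so two-sided derivatives exist
  -- at the endpoints too.
  let γ' : ℝ → E := fun s => x + ∫ τ in (0 : ℝ)..s, V (γ (projIcc 0 1 zero_le_one τ))
  have hc : Continuous fun τ => V (γ (projIcc 0 1 zero_le_one τ)) :=
    hV.comp (γ.continuous.comp continuous_projIcc)
  have hγ' : ∀ s, ∀ hs : s ∈ Icc (0 : ℝ) 1, γ' s = γ ⟨s, hs⟩ := fun s hs => (hγ ⟨s, hs⟩).symm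
  have hd : ∀ s ∈ Icc (0 : ℝ) 1, HasDerivAt (g ∘ γ') 0 s := by
    intro s hs
    have h1 : HasDerivAt γ' (V (γ' s)) s := by
      have h := (intervalIntegral.integral_hasDerivAt_right (hc.intervalIntegrable 0 s)
        (hc.stronglyMeasurableAtFilter _ _) hc.continuousAt).const_add x
      rwa [projIcc_of_mem zero_le_one hs, ← hγ' s hs] at h
    have hO' : γ' s ∈ O := by rw [hγ' s hs]; exact hγO _
    have h2 := ((hg.differentiableAt (hO.mem_nhds hO')).hasFDerivAt).comp_hasDerivAt s h1
    rwa [hgV _ hO'] at h2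
  have := constant_of_has_deriv_right_zero (f := g ∘ γ') (a := 0) (b := 1)
    (fun s hs => (hd s hs).continuousAt.continuousWithinAt)
    (fun s hs => (hd s (Ico_subset_Icc_self hs)).hasDerivWithinAt) 1 (by simp)
  have h0 : γ' 0 = x := by simp [γ']
  have h1 : γ' 1 = γ 1 := hγ' 1 (by simp)
  simpa [h0, h1] using this

/-- Simultaneous straightening of independent vector fields along which `g` is constant: there
are coordinates `(t, w)` in which `g` does not depend on `t`. -/
theorem exists_straightening [FiniteDimensional ℝ E] {G : Type*} [NormedAddCommGroup G]
    [NormedSpace ℝ G] {g : E → G} {O : Set E} (hO : IsOpen O) {x₀ : E} (hx₀ : x₀ ∈ O)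
    (hg : ContDiffOn ℝ ∞ g O) (X : Fin k → E → E) (hX : ∀ i, ContDiffOn ℝ ∞ (X i) O)
    (hgX : ∀ i, ∀ x ∈ O, fderiv ℝ g x (X i x) = 0)
    (hli : LinearIndependent ℝ fun i => X i x₀) :
    ∃ (m : ℕ) (e : OpenPartialHomeomorph
        (EuclideanSpace ℝ (Fin k) × EuclideanSpace ℝ (Fin m)) E)
      (g' : EuclideanSpace ℝ (Fin m) → G), x₀ ∈ e.target ∧ e.target ⊆ O ∧
      ContDiffOn ℝ ∞ e e.source ∧ ContDiffOn ℝ ∞ e.symm e.target ∧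
      (∀ p ∈ e.source, DifferentiableAt ℝ g' p.2) ∧
      ∀ p ∈ e.source, g (e p) = g' p.2 := by
  -- The composition operators need globally smooth fields. The `Y i` agree with the `X i` near
  -- `x₀`, and all curves below stay in that neighbourhood.
  choose Y hY hYX using fun i => (hX i).exists_contDiff_eventuallyEq (hO.mem_nhds hx₀)
  obtain ⟨O', hO'sub, hO'o, hO'x⟩ := mem_nhds_iff.1
    ((eventually_all.2 hYX).and (hO.mem_nhds hx₀))
  obtain ⟨Γ, hΓ0, hΓs, hΓi, D, hD, hD1⟩ := exists_smooth_integral_family Y hY x₀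
  have hYx₀ : ∀ i, Y i x₀ = X i x₀ := fun i => (hO'sub hO'x).1 i
  let S : Submodule ℝ E := Submodule.span ℝ (range fun i => X i x₀)
  obtain ⟨S', hS'⟩ := S.exists_isCompl
  let P := EuclideanSpace ℝ (Fin k)
  let m := Module.finrank ℝ S'
  let Q := EuclideanSpace ℝ (Fin m)
  let bS : Module.Basis (Fin k) ℝ S := Module.Basis.span hli
  let LS : P ≃ₗ[ℝ] S := (EuclideanSpace.basisFun (Fin k) ℝ).toBasis.equiv bS (Equiv.refl _)
  let LS' : Q ≃ₗ[ℝ] S' :=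
    (EuclideanSpace.basisFun (Fin m) ℝ).toBasis.equiv (Module.finBasis ℝ S') (Equiv.refl _)
  -- A linear splitting of `E` into the span of the `X i x₀` and a complement. It turns out to be
  -- the derivative at `0` of the straightening map.
  let L : (P × Q) ≃L[ℝ] E :=
    ((LS.prodCongr LS').trans (Submodule.prodEquivOfIsCompl S S' hS')).toContinuousLinearEquiv
  have hL : ∀ t w, L (t, w) = (∑ i, t i • X i x₀) + LS' w := by
    intro t w
    change ((LS t : S) : E) + (LS' w : S') = _
    congr 1
    have : LS t = ∑ i, t i • bS i := by
      conv_lhs => rw [← (EuclideanSpace.basisFun (Fin k) ℝ).toBasis.sum_repr t]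
      rw [map_sum]
      refine Finset.sum_congr rfl fun i _ => ?_
      rw [map_smul, Module.Basis.equiv_apply]
      simp
    rw [this]
    have hb : ∀ i, ((bS i : S) : E) = X i x₀ := fun i => congrArg Subtype.val (Module.Basis.span_apply hli i)
    simp [hb]
  let σ : Q →L[ℝ] E := (L : P × Q →L[ℝ] E).comp (ContinuousLinearMap.inr ℝ P Q)
  have hσ : ∀ w, σ w = LS' w := fun w => by
    change L (0, w) = _
    rw [hL]; simp
  let θ : P × Q → P × E := fun p => (p.1, x₀ + σ p.2)
  have hθ : ContDiff ℝ ∞ θ :=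
    contDiff_fst.prodMk (contDiff_const.add (σ.contDiff.comp contDiff_snd))
  have hθ0 : θ 0 = (0, x₀) := by simp [θ]
  have hθt : Tendsto θ (𝓝 0) (𝓝 (0, x₀)) := by
    have := hθ.continuous.tendsto 0
    rwa [hθ0] at this
  -- Start at the slice point `x₀ + σ w` and follow `∑ t i • Y i` for unit time.
  let ψ : P × Q → E := fun p => Γ (θ p) 1
  have hΓO : ∀ᶠ p in 𝓝 ((0 : P), x₀), ∀ s, Γ p s ∈ O' := by
    -- Staying inside `O'` for all times is an open condition in the compact-open topology.
    have h1 : IsOpen {γ : C(unitInterval, E) | MapsTo γ univ O'} :=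
      ContinuousMap.isOpen_setOfPred_mapsTo isCompact_univ hO'o
    have h2 : ContinuousAt Γ (0, x₀) := hΓs.self_of_nhds.continuousAt
    have h3 := h2.preimage_mem_nhds (h1.mem_nhds (by rw [hΓ0]; intro s _; exact hO'x))
    filter_upwards [h3] with p hp s
    exact hp (mem_univ s)
  have hcO : ∀ᶠ p in 𝓝 ((0 : P), x₀), p.2 ∈ O' :=
    continuousAt_snd.preimage_mem_nhds (hO'o.mem_nhds hO'x)
  obtain ⟨U, hUsub, hUo, hU0⟩ := mem_nhds_iff.1
    (hθt.eventually (hΓs.and (hΓi.and (hΓO.and hcO))))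
  have hψ : ContDiffOn ℝ ∞ ψ U := by
    intro p hp
    have h1 : ContDiffAt ℝ ∞ Γ (θ p) := (hUsub hp).1
    have h2 : ContDiff ℝ ∞ (fun γ : C(unitInterval, E) => γ 1) :=
      (ContinuousMap.evalCLM ℝ (1 : unitInterval) : C(unitInterval, E) →L[ℝ] E).contDiff
    exact (h2.contDiffAt.comp p (h1.comp p hθ.contDiffAt)).contDiffWithinAt
  have hψ' : HasFDerivAt ψ (L : P × Q →L[ℝ] E) 0 := by
    have h1 : HasFDerivAt θ ((ContinuousLinearMap.fst ℝ P Q).prod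
        (σ.comp (ContinuousLinearMap.snd ℝ P Q))) 0 :=
      hasFDerivAt_fst.prodMk ((σ.hasFDerivAt.comp 0 hasFDerivAt_snd).const_add x₀)
    have h2 : HasFDerivAt Γ D (θ 0) := by rw [hθ0]; exact hD
    have h3 := (ContinuousMap.evalCLM ℝ (1 : unitInterval) :
      C(unitInterval, E) →L[ℝ] E).hasFDerivAt.comp 0 (h2.comp 0 h1)
    refine h3.congr_fderiv (ContinuousLinearMap.ext fun p => ?_)
    change D (p.1, σ p.2) 1 = L (p.1, p.2)
    rw [hD1, hL, hσ, add_comm]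
    simp [hYx₀]
  obtain ⟨e, he, h0, heU, hes⟩ := hψ.exists_openPartialHomeomorph hUo hU0 L hψ'
  have hψ0 : ψ 0 = x₀ := by
    simp only [ψ, hθ0, hΓ0]; rfl
  refine ⟨m, e, fun w => g (x₀ + σ w), ?_, ?_, ?_, hes, ?_, ?_⟩
  · rw [← hψ0, ← he]; exact e.map_source h0
  · intro y hy
    have hy' := heU (e.map_target hy)
    rw [← e.right_inv hy, he]
    exact (hO'sub ((hUsub hy').2.2.1 1)).2
  · rw [he]; exact hψ.mono heU
  · intro p hp
    have h1 : x₀ + σ p.2 ∈ O := (hO'sub (hUsub (heU hp)).2.2.2).2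
    have h2 : DifferentiableAt ℝ g (x₀ + σ p.2) :=
      (hg.contDiffAt (hO.mem_nhds h1)).differentiableAt (by simp)
    exact DifferentiableAt.fun_comp' p.2 h2 (by fun_prop)
  · intro p hp
    rw [he]
    obtain ⟨-, hi, hO2, -⟩ := hUsub (heU hp)
    refine first_integral_eq_of_integral_eq (V := fun x => ∑ i, p.1 i • Y i x) hO'o
      ((hg.differentiableOn (by simp)).mono fun x hx => (hO'sub hx).2) ?_ ?_ (Γ (θ p)) hO2 _ hi
    · exact continuous_finsetSum _ fun i _ => continuous_const.smul (hY i).continuous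
    · intro x hx
      simp only [map_sum, map_smul]
      refine Finset.sum_eq_zero fun i _ => ?_
      rw [(hO'sub hx).1 i, hgX i x (hO'sub hx).2, smul_zero]

end Straightening

/-! ### Lie brackets and first integrals; the variational equation -/

section Calculus

variable {E G : Type*} [NormedAddCommGroup E] [NormedSpace ℝ E] [NormedAddCommGroup G]
  [NormedSpace ℝ G]

/-- Differentiating `Dg(V) = 0` along `W` gives `D²g(W, V) + Dg(DV W) = 0`, and likewise with `V`
and `W` exchanged. The second derivatives cancel by symmetry. -/
lemma fderiv_lieBracket_eq_zero {g : E → G} {V W : E → E} {p : E} (hg : ContDiffAt ℝ ∞ g p)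
    (hV : DifferentiableAt ℝ V p) (hW : DifferentiableAt ℝ W p)
    (hgV : ∀ᶠ q in 𝓝 p, fderiv ℝ g q (V q) = 0) (hgW : ∀ᶠ q in 𝓝 p, fderiv ℝ g q (W q) = 0) :
    fderiv ℝ g p (VectorField.lieBracket ℝ V W p) = 0 := by
  have hD : DifferentiableAt ℝ (fderiv ℝ g) p :=
    (hg.fderiv_right (m := 1) (by norm_cast)).differentiableAt one_ne_zero
  have key : ∀ Z : E → E, DifferentiableAt ℝ Z p → (∀ᶠ q in 𝓝 p, fderiv ℝ g q (Z q) = 0) →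
      ∀ v, fderiv ℝ (fderiv ℝ g) p v (Z p) + fderiv ℝ g p (fderiv ℝ Z p v) = 0 := by
    intro Z hZ hgZ v
    have h1 := hD.hasFDerivAt.clm_apply hZ.hasFDerivAt
    have h2 : HasFDerivAt (fun q => fderiv ℝ g q (Z q)) (0 : E →L[ℝ] G) p :=
      (hasFDerivAt_const (0 : G) p).congr_of_eventuallyEq hgZ
    have h3 := DFunLike.congr_fun (h1.unique h2) v
    rw [add_comm]
    simpa using h3
  have hs : IsSymmSndFDerivAt ℝ g p := hg.isSymmSndFDerivAt (by simp; exact ENat.LEInfty.out)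
  have hv := key V hV hgV (W p)
  have hw := key W hW hgW (V p)
  rw [VectorField.lieBracket, map_sub, eq_neg_of_add_eq_zero_right hw,
    eq_neg_of_add_eq_zero_right hv, hs.eq (V p) (W p)]
  simp

/-- The kernel of the space derivative of a solution of an autonomous differential equation is
locally constant in time. -/
lemma eventually_fderiv_flow_eq_zero_iff {Φ : ℝ × E → E} {V : E → E} {s₀ : ℝ} {p₀ : E}
    (hΦ : ∀ᶠ q in 𝓝 (s₀, p₀), ContDiffAt ℝ ∞ Φ q) (hV : ContDiffAt ℝ ∞ V (Φ (s₀, p₀)))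
    (hΦV : ∀ᶠ q in 𝓝 (s₀, p₀), HasDerivAt (fun s => Φ (s, q.2)) (V (Φ q)) q.1) :
    ∀ᶠ s in 𝓝 s₀, ∀ v, fderiv ℝ (fun p => Φ (s, p)) p₀ v = 0 ↔
      fderiv ℝ (fun p => Φ (s₀, p)) p₀ v = 0 := by
  have hV1 : ContDiffAt ℝ 1 V (Φ (s₀, p₀)) := hV.of_le (by exact_mod_cast le_top)
  have hΦc : ContinuousAt Φ (s₀, p₀) := hΦ.self_of_nhds.continuousAt
  let B : ℝ → E →L[ℝ] E := fun s => fderiv ℝ V (Φ (s, p₀))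
  have hcurve : ContinuousAt (fun s : ℝ => (s, p₀)) s₀ := by fun_prop
  have hBc : ContinuousAt B s₀ :=
    ContinuousAt.comp (f := fun s : ℝ => Φ (s, p₀)) (g := fderiv ℝ V)
      (hV1.fderiv_right (m := 0) (by simp)).continuousAt
      (ContinuousAt.comp (f := fun s : ℝ => (s, p₀)) (g := Φ) hΦc hcurve)
  have hVd : ∀ᶠ s in 𝓝 s₀, DifferentiableAt ℝ V (Φ (s, p₀)) := by
    have h1 := (hV1.eventually (by simp)).mono fun x hx => hx.differentiableAt one_ne_zero
    exact (ContinuousAt.comp (f := fun s : ℝ => (s, p₀)) (g := Φ) hΦc hcurve).eventually h1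
  have hBb : ∀ᶠ s in 𝓝 s₀, ‖B s‖ < ‖B s₀‖ + 1 :=
    hBc.norm.eventually_lt continuousAt_const (by simp)
  obtain ⟨a, b, hab, hsub⟩ := mem_nhds_iff_exists_Ioo_subset.1
    (hVd.and (hBb.and (hcurve.eventually (hΦ.and hΦV.eventually_nhds))))
  have hsplit : ∀ s ∈ Ioo a b, ∀ v, fderiv ℝ (fun p => Φ (s, p)) p₀ v =
      fderiv ℝ Φ (s, p₀) (0, v) := by
    intro s hs v
    have h1 : HasFDerivAt Φ (fderiv ℝ Φ (s, p₀)) (s, p₀) :=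
      ((hsub hs).2.2.1.differentiableAt (by simp)).hasFDerivAt
    have h2 := h1.comp p₀ (hasFDerivAt_prodMk_right s p₀)
    exact DFunLike.congr_fun h2.fderiv v
  -- The variational equation `u' = DV(Φ) u` for `u = ∂Φ(v)`: differentiate `∂ₛΦ = V ∘ Φ` in the
  -- direction `v` and exchange the derivatives by symmetry.
  have hu : ∀ s ∈ Ioo a b, ∀ v, HasDerivAt (fun s => fderiv ℝ Φ (s, p₀) (0, v))
      (B s (fderiv ℝ Φ (s, p₀) (0, v))) s := by
    intro s hs v
    obtain ⟨hVs, -, hs1, hs2⟩ := hsub hs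
    have hD : DifferentiableAt ℝ (fderiv ℝ Φ) (s, p₀) :=
      (hs1.fderiv_right (m := 1) (by norm_cast)).differentiableAt one_ne_zero
    have h1 : HasDerivAt (fun s => fderiv ℝ Φ (s, p₀) (0, v))
        (fderiv ℝ (fderiv ℝ Φ) (s, p₀) (1, 0) (0, v)) s := by
      have h := hD.hasFDerivAt.comp_hasDerivAt s ((hasDerivAt_id s).prodMk (hasDerivAt_const s p₀))
      simpa using h.clm_apply (hasDerivAt_const s ((0 : ℝ), v))
    have h2 : (fun q => fderiv ℝ Φ q (1, 0)) =ᶠ[𝓝 (s, p₀)] fun q => V (Φ q) := by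
      have hs1' : ∀ᶠ q in 𝓝 (s, p₀), DifferentiableAt ℝ Φ q :=
        ((hs1.of_le (m := 1) (by exact_mod_cast le_top)).eventually (by simp)).mono
          fun q hq => hq.differentiableAt one_ne_zero
      filter_upwards [hs1', hs2] with q hq hq2
      have h := hq.hasFDerivAt.comp_hasDerivAt q.1
        ((hasDerivAt_id q.1).prodMk (hasDerivAt_const q.1 q.2))
      exact h.unique hq2
    have h3 : fderiv ℝ (fderiv ℝ Φ) (s, p₀) (0, v) (1, 0) =
        B s (fderiv ℝ Φ (s, p₀) (0, v)) := by
      have ha := (hD.hasFDerivAt.clm_apply (hasFDerivAt_const ((1 : ℝ), (0 : E)) (s, p₀)))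
      have hb : HasFDerivAt (fun q => V (Φ q)) _ (s, p₀) :=
        HasFDerivAt.comp (s, p₀) hVs.hasFDerivAt (hs1.differentiableAt (by simp)).hasFDerivAt
      have hc := DFunLike.congr_fun (ha.unique (hb.congr_of_eventuallyEq h2)) (0, v)
      simpa using hc
    have hsym : IsSymmSndFDerivAt ℝ Φ (s, p₀) := hs1.isSymmSndFDerivAt (by simp; exact ENat.LEInfty.out)
    rw [← h3, ← hsym.eq (1, 0) (0, v)]
    exact h1
  have hLip : ∀ s ∈ Ioo a b, LipschitzOnWith ⟨‖B s₀‖ + 1, by positivity⟩ (B s) univ := by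
    intro s hs
    refine ((B s).lipschitz.weaken ?_).lipschitzOnWith
    exact (hsub hs).2.1.le
  -- A solution of a linear equation that vanishes at one time vanishes throughout the interval.
  have huniq : ∀ v, ∀ s₁ ∈ Ioo a b, fderiv ℝ Φ (s₁, p₀) (0, v) = 0 →
      ∀ s ∈ Ioo a b, fderiv ℝ Φ (s, p₀) (0, v) = 0 := by
    intro v s₁ hs₁ h0 s hs
    exact ODE_solution_unique_of_mem_Ioo (v := fun s => B s) (s := fun _ => univ) hLip hs₁
      (fun s hs => ⟨hu s hs v, mem_univ _⟩)
      (g := fun _ => 0) (fun s hs => ⟨by simpa using hasDerivAt_const s (0 : E), mem_univ _⟩)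
      h0 hs
  filter_upwards [Ioo_mem_nhds hab.1 hab.2] with s hs v
  rw [hsplit s hs, hsplit s₀ hab]
  exact ⟨fun h => huniq v s hs h s₀ hab, fun h => huniq v s₀ hab h s hs⟩

end Calculus

/-! ### Distributions generated by smooth vector fields -/

section Generated

variable {E : Type*} [NormedAddCommGroup E] [NormedSpace ℝ E] {M : Type*} [TopologicalSpace M]
  [ChartedSpace E M] [IsManifold 𝓘(ℝ, E) ∞ M]
  {E' : Type*} [NormedAddCommGroup E'] [NormedSpace ℝ E'] {N : Type*} [TopologicalSpace N]
  [ChartedSpace E' N] [IsManifold 𝓘(ℝ, E') ∞ N]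

/-- The values at `x` of the smooth vector fields near `x` that are tangent to `K`. -/
def generatedDistribution (K : ∀ x : M, Submodule ℝ (TangentSpace 𝓘(ℝ, E) x)) (x : M) :
    Submodule ℝ (TangentSpace 𝓘(ℝ, E) x) where
  carrier := {v | ∃ X : ∀ z : M, TangentSpace 𝓘(ℝ, E) z, X x = v ∧ ∀ᶠ z in 𝓝 x,
    ContMDiffAt 𝓘(ℝ, E) 𝓘(ℝ, E).tangent ∞
      (fun z => (⟨z, X z⟩ : TangentBundle 𝓘(ℝ, E) M)) z ∧ X z ∈ K z}
  zero_mem' := ⟨fun _ => 0, rfl, Eventually.of_forall fun _ =>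
    ⟨Bundle.contMDiffAt_zeroSection ℝ _, Submodule.zero_mem _⟩⟩
  add_mem' := by
    rintro v w ⟨X, rfl, hX⟩ ⟨Y, rfl, hY⟩
    refine ⟨fun z => X z + Y z, rfl, ?_⟩
    filter_upwards [hX, hY] with z hXz hYz
    exact ⟨hXz.1.add_section hYz.1, Submodule.add_mem _ hXz.2 hYz.2⟩
  smul_mem' := by
    rintro c v ⟨X, rfl, hX⟩
    refine ⟨fun z => c • X z, rfl, ?_⟩
    filter_upwards [hX] with z hXz
    exact ⟨hXz.1.const_smul_section, Submodule.smul_mem _ _ hXz.2⟩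

omit [IsManifold 𝓘(ℝ, E) ∞ M] in
-- Tangent spaces at equal points are definitionally the same model space, so `id` transports the
-- vector.
lemma mem_submodule_congr_base {D : ∀ x : M, Submodule ℝ (TangentSpace 𝓘(ℝ, E) x)} {x y : M}
    (h : x = y) {v : TangentSpace 𝓘(ℝ, E) x} :
    v ∈ D x ↔ (id v : TangentSpace 𝓘(ℝ, E) y) ∈ D y := by
  subst h; rfl

/-- A partial homeomorphism that is smooth together with its inverse. -/
structure OpenPartialHomeomorph.IsSmooth (φ : OpenPartialHomeomorph M N) : Prop where
  contMDiffOn : ContMDiffOn 𝓘(ℝ, E) 𝓘(ℝ, E') ∞ φ φ.source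
  contMDiffOn_symm : ContMDiffOn 𝓘(ℝ, E') 𝓘(ℝ, E) ∞ φ.symm φ.target

namespace OpenPartialHomeomorph.IsSmooth

variable {φ : OpenPartialHomeomorph M N} (hφ : φ.IsSmooth (E := E) (E' := E'))
include hφ

omit [IsManifold 𝓘(ℝ, E) ∞ M] [IsManifold 𝓘(ℝ, E') ∞ N] in
lemma symm : φ.symm.IsSmooth (E := E') (E' := E) :=
  ⟨hφ.contMDiffOn_symm, by simpa using hφ.contMDiffOn⟩

omit [IsManifold 𝓘(ℝ, E) ∞ M] [IsManifold 𝓘(ℝ, E') ∞ N] in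
lemma mdifferentiable : φ.MDifferentiable 𝓘(ℝ, E) 𝓘(ℝ, E') :=
  ⟨hφ.contMDiffOn.mdifferentiableOn (by simp), hφ.contMDiffOn_symm.mdifferentiableOn (by simp)⟩

omit [IsManifold 𝓘(ℝ, E) ∞ M] [IsManifold 𝓘(ℝ, E') ∞ N] in
lemma isInvertible_mfderiv {x : M} (hx : x ∈ φ.source) :
    (mfderiv 𝓘(ℝ, E) 𝓘(ℝ, E') φ x).IsInvertible :=
  ⟨hφ.mdifferentiable.mfderiv hx, rfl⟩

/-- The pullback by `φ` of a field tangent to `K'` is tangent to `K`. The hypothesis on `K` and `K'`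
is needed at all points near `x`, since sections are germs. -/
lemma mem_generatedDistribution_of_mfderiv [CompleteSpace E]
    {K : ∀ x : M, Submodule ℝ (TangentSpace 𝓘(ℝ, E) x)}
    {K' : ∀ y : N, Submodule ℝ (TangentSpace 𝓘(ℝ, E') y)} {x : M} (hx : x ∈ φ.source)
    (hK : ∀ᶠ z in 𝓝 x, ∀ v, v ∈ K z ↔ mfderiv 𝓘(ℝ, E) 𝓘(ℝ, E') φ z v ∈ K' (φ z))
    {v : TangentSpace 𝓘(ℝ, E) x}
    (hv : mfderiv 𝓘(ℝ, E) 𝓘(ℝ, E') φ x v ∈ generatedDistribution K' (φ x)) :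
    v ∈ generatedDistribution K x := by
  obtain ⟨Y, hYx, hY⟩ := hv
  have hinv : ∀ z ∈ φ.source, (mfderiv 𝓘(ℝ, E) 𝓘(ℝ, E') φ z).IsInvertible :=
    fun z hz => hφ.isInvertible_mfderiv hz
  refine ⟨VectorField.mpullback 𝓘(ℝ, E) 𝓘(ℝ, E') φ Y, ?_, ?_⟩
  · rw [VectorField.mpullback_apply, hYx]
    obtain ⟨e, he⟩ := hinv x hx
    rw [← he]
    simp
  · filter_upwards [hK, φ.open_source.mem_nhds hx, (φ.continuousAt hx).eventually hY]
      with z hKz hz hYz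
    refine ⟨hYz.1.mpullback_vectorField_preimage
      (hφ.contMDiffOn.contMDiffAt (φ.open_source.mem_nhds hz)) (hinv z hz) le_rfl, ?_⟩
    rw [hKz, VectorField.mpullback_apply]
    obtain ⟨e, he⟩ := hinv z hz
    rw [← he]
    simpa using hYz.2

/-- Naturality of generated distributions under local diffeomorphisms. -/
lemma mem_generatedDistribution_iff [CompleteSpace E] [CompleteSpace E']
    {K : ∀ x : M, Submodule ℝ (TangentSpace 𝓘(ℝ, E) x)}
    {K' : ∀ y : N, Submodule ℝ (TangentSpace 𝓘(ℝ, E') y)} {x : M} (hx : x ∈ φ.source)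
    (hK : ∀ᶠ z in 𝓝 x, ∀ v, v ∈ K z ↔ mfderiv 𝓘(ℝ, E) 𝓘(ℝ, E') φ z v ∈ K' (φ z))
    (v : TangentSpace 𝓘(ℝ, E) x) :
    v ∈ generatedDistribution K x ↔
      mfderiv 𝓘(ℝ, E) 𝓘(ℝ, E') φ x v ∈ generatedDistribution K' (φ x) := by
  refine ⟨fun hv => ?_, hφ.mem_generatedDistribution_of_mfderiv hx hK⟩
  have hy : φ x ∈ φ.symm.source := φ.map_source hx
  refine hφ.symm.mem_generatedDistribution_of_mfderiv (K' := K) hy ?_ ?_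
  · have ht : Tendsto φ.symm (𝓝 (φ x)) (𝓝 x) := by
      have := φ.symm.continuousAt hy
      rwa [ContinuousAt, φ.left_inv hx] at this
    filter_upwards [ht.eventually hK, φ.open_target.mem_nhds hy] with w hw hwt u
    rw [hw]
    refine Iff.trans ?_ (mem_submodule_congr_base (D := K') (φ.right_inv hwt)).symm
    have h := DFunLike.congr_fun (hφ.mdifferentiable.comp_symm_deriv hwt) u
    exact iff_of_eq (congrArg (· ∈ K' w) h.symm)
  · refine (mem_submodule_congr_base (D := generatedDistribution K) (φ.left_inv hx)).2 ?_
    have h := DFunLike.congr_fun (hφ.mdifferentiable.symm_comp_deriv hx) v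
    exact (iff_of_eq (congrArg (· ∈ generatedDistribution K x) h)).2 hv

end OpenPartialHomeomorph.IsSmooth
end Generated

/-! ### The tangent sheaf of a Haefliger cocycle -/

section ManifoldCalculus

variable {E : Type*} [NormedAddCommGroup E] [NormedSpace ℝ E] {M : Type*} [TopologicalSpace M]
  [ChartedSpace E M] [IsManifold 𝓘(ℝ, E) ∞ M]
  {G : Type*} [NormedAddCommGroup G] [NormedSpace ℝ G]

lemma isSmooth_chartAt (x : M) : (chartAt E x).IsSmooth (E := E) (E' := E) :=
  ⟨contMDiffOn_chart, contMDiffOn_chart_symm⟩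

/-- Brackets are natural under pullback, so pulling back along the inverse of a chart reduces the
claim to `fderiv_lieBracket_eq_zero`. -/
lemma mfderiv_mlieBracket_eq_zero [CompleteSpace E] {f : M → G}
    {X Y : ∀ x : M, TangentSpace 𝓘(ℝ, E) x}
    {x : M} (hf : ∀ᶠ z in 𝓝 x, ContMDiffAt 𝓘(ℝ, E) 𝓘(ℝ, G) ∞ f z)
    (hX : ContMDiffAt 𝓘(ℝ, E) 𝓘(ℝ, E).tangent ∞
      (fun z => (⟨z, X z⟩ : TangentBundle 𝓘(ℝ, E) M)) x)
    (hY : ContMDiffAt 𝓘(ℝ, E) 𝓘(ℝ, E).tangent ∞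
      (fun z => (⟨z, Y z⟩ : TangentBundle 𝓘(ℝ, E) M)) x)
    (hfX : ∀ᶠ z in 𝓝 x, mfderiv 𝓘(ℝ, E) 𝓘(ℝ, G) f z (X z) = 0)
    (hfY : ∀ᶠ z in 𝓝 x, mfderiv 𝓘(ℝ, E) 𝓘(ℝ, G) f z (Y z) = 0) :
    mfderiv 𝓘(ℝ, E) 𝓘(ℝ, G) f x (VectorField.mlieBracket 𝓘(ℝ, E) X Y x) = 0 := by
  have hi : IsManifold 𝓘(ℝ, E) (minSmoothness ℝ 2) M :=
    IsManifold.of_le (n := ∞) (by simp; exact ENat.LEInfty.out)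
  have hi2 : IsManifold 𝓘(ℝ, E) 2 M := IsManifold.of_le (n := ∞) ENat.LEInfty.out
  set ψ := (chartAt E x).symm with hψdef
  have hψ : ψ.IsSmooth (E := E) (E' := E) := (isSmooth_chartAt x).symm
  set p : E := chartAt E x x with hpdef
  have hp : p ∈ ψ.source := (chartAt E x).map_source (mem_chart_source E x)
  have hpx : ψ p = x := (chartAt E x).left_inv (mem_chart_source E x)
  have hψs : ψ.source ∈ 𝓝 p := ψ.open_source.mem_nhds hp
  have hψat : ∀ q ∈ ψ.source, ContMDiffAt 𝓘(ℝ, E) 𝓘(ℝ, E) ∞ ψ q :=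
    fun q hq => hψ.contMDiffOn.contMDiffAt (ψ.open_source.mem_nhds hq)
  have ht : Tendsto ψ (𝓝 p) (𝓝 x) := by
    have := ψ.continuousAt hp
    rwa [ContinuousAt, hpx] at this
  rw [← hpx] at hX hY ⊢
  have hfp : ContMDiffAt 𝓘(ℝ, E) 𝓘(ℝ, G) ∞ f (ψ p) := by
    rw [hpx]; exact hf.self_of_nhds
  have hcomp : ∀ q ∈ ψ.source, ContMDiffAt 𝓘(ℝ, E) 𝓘(ℝ, G) ∞ f (ψ q) → ∀ v,
      mfderiv 𝓘(ℝ, E) 𝓘(ℝ, G) f (ψ q) v =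
        fderiv ℝ (f ∘ ψ) q ((mfderiv 𝓘(ℝ, E) 𝓘(ℝ, E) ψ q).inverse v) := by
    intro q hq hfq v
    have h1 := mfderiv_comp q (hfq.mdifferentiableAt (by simp))
      ((hψat q hq).mdifferentiableAt (by simp))
    rw [mfderiv_eq_fderiv] at h1
    rw [h1]
    obtain ⟨e, he⟩ := hψ.isInvertible_mfderiv hq
    have h2 : mfderiv 𝓘(ℝ, E) 𝓘(ℝ, E) ψ q ((mfderiv 𝓘(ℝ, E) 𝓘(ℝ, E) ψ q).inverse v) = v := by
      rw [← he]; simp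
    exact (congrArg (mfderiv 𝓘(ℝ, E) 𝓘(ℝ, G) f (ψ q)) h2).symm
  have hg : ContDiffAt ℝ ∞ (f ∘ ψ) p := (hfp.comp p (hψat p hp)).contDiffAt
  have hpull : ∀ Z : ∀ x : M, TangentSpace 𝓘(ℝ, E) x,
      ContMDiffAt 𝓘(ℝ, E) 𝓘(ℝ, E).tangent ∞
        (fun z => (⟨z, Z z⟩ : TangentBundle 𝓘(ℝ, E) M)) (ψ p) →
      (∀ᶠ z in 𝓝 x, mfderiv 𝓘(ℝ, E) 𝓘(ℝ, G) f z (Z z) = 0) →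
      DifferentiableAt ℝ (VectorField.mpullback 𝓘(ℝ, E) 𝓘(ℝ, E) ψ Z) p ∧
      ∀ᶠ q in 𝓝 p, fderiv ℝ (f ∘ ψ) q (VectorField.mpullback 𝓘(ℝ, E) 𝓘(ℝ, E) ψ Z q) = 0 := by
    intro Z hZ hfZ
    constructor
    · have h := hZ.mpullback_vectorField_preimage (m := ∞) (hψat p hp)
        (hψ.isInvertible_mfderiv hp) le_rfl
      exact (contMDiffAt_vectorSpace_iff_contDiffAt.1 h).differentiableAt (by simp)
    · filter_upwards [hψs, ht.eventually (hf.and hfZ)] with q hq hq2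
      exact (hcomp q hq hq2.1 (Z (ψ q))).symm.trans hq2.2
  obtain ⟨hX1, hX2⟩ := hpull X hX hfX
  obtain ⟨hY1, hY2⟩ := hpull Y hY hfY
  have hbr := VectorField.mpullback_mlieBracket (hX.mdifferentiableAt (by simp))
    (hY.mdifferentiableAt (by simp)) (hψat p hp) (by simp; exact ENat.LEInfty.out)
  rw [← VectorField.mlieBracketWithin_univ (V := VectorField.mpullback _ _ ψ X),
    VectorField.mlieBracketWithin_eq_lieBracketWithin] at hbr
  refine (hcomp p hp hfp _).trans ?_
  have h3 := fderiv_lieBracket_eq_zero hg hX1 hY1 hX2 hY2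
  have h4 := hbr.trans (congrFun VectorField.lieBracketWithin_univ p)
  exact (congrArg (fderiv ℝ (f ∘ ψ) p) h4).trans h3

end ManifoldCalculus

/-! ### The subsheaf, its involutivity and its independence of the cocycle -/

namespace HaefligerCocycle

variable {n q : ℕ} {M : Type u} [TopologicalSpace M] [ChartedSpace (EuclideanSpace ℝ (Fin n)) M]
  {ι : Type v} {ι' : Type w}

/-- The chain rule for `f_a = h ∘ f_b`. Only differentiability of `h` enters; the reverse inclusion
of kernels follows by exchanging `a` and `b`. -/
lemma mfderiv_eq_zero_of_mem (c : HaefligerCocycle n q M ι) {a b : ι} {x : M} (ha : x ∈ c.U a)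
    (hb : x ∈ c.U b) {v : TangentSpace (𝓡 n) x}
    (hv : mfderiv (𝓡 n) (𝓡 q) (c.f b) x v = 0) : mfderiv (𝓡 n) (𝓡 q) (c.f a) x v = 0 := by
  have h1 : c.f a =ᶠ[𝓝 x] c.h a b x ∘ c.f b := c.compat a b x ha hb
  rw [h1.mfderiv_eq, mfderiv_comp x ((c.localDiffeo_h a b x ha hb).mdifferentiableAt (by simp))
    (((c.smooth_f b).contMDiffAt ((c.U b).isOpen.mem_nhds hb)).mdifferentiableAt (by simp))]
  refine (congrArg (mfderiv (𝓡 q) (𝓡 q) (c.h a b x) (c.f b x)) hv).trans ?_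
  exact map_zero _

/-- The common kernel of the differentials of the Haefliger charts. -/
noncomputable def kernel (c : HaefligerCocycle n q M ι) (x : M) :
    Submodule ℝ (TangentSpace (𝓡 n) x) :=
  ⨅ (a : ι) (_ : x ∈ c.U a), LinearMap.ker (mfderiv (𝓡 n) (𝓡 q) (c.f a) x).toLinearMap

lemma mem_kernel_iff_forall (c : HaefligerCocycle n q M ι) {x : M} {v : TangentSpace (𝓡 n) x} :
    v ∈ c.kernel x ↔ ∀ a, x ∈ c.U a → mfderiv (𝓡 n) (𝓡 q) (c.f a) x v = 0 := by
  simp only [kernel, Submodule.mem_iInf]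
  rfl

lemma mem_kernel (c : HaefligerCocycle n q M ι) {a : ι} {x : M} (ha : x ∈ c.U a)
    {v : TangentSpace (𝓡 n) x} :
    v ∈ c.kernel x ↔ mfderiv (𝓡 n) (𝓡 q) (c.f a) x v = 0 := by
  rw [mem_kernel_iff_forall]
  exact ⟨fun h => h a ha, fun h b hb => c.mfderiv_eq_zero_of_mem hb ha h⟩

lemma contMDiffAt_f (c : HaefligerCocycle n q M ι) {a : ι} {x : M} (ha : x ∈ c.U a) :
    ContMDiffAt (𝓡 n) (𝓡 q) ∞ (c.f a) x :=
  (c.smooth_f a).contMDiffAt ((c.U a).isOpen.mem_nhds ha)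

variable [IsManifold (𝓡 n) ∞ M]

lemma mem_sheaf (c : HaefligerCocycle n q M ι) {U : Opens M} {X : RoughVectorField n M} :
    X ∈ c.sheaf U ↔ IsSmoothVectorFieldOn U X ∧ ∀ y ∈ U, X y ∈ c.kernel y := by
  simp only [sheaf, mem_ofPred_eq, mem_kernel_iff_forall]
  refine and_congr_right fun _ => ⟨fun h y hy a ha => ?_, fun h a i y hy ha => ?_⟩
  · refine PiLp.ext fun i => ?_
    exact h a i y hy ha
  · exact congrArg (fun u : EuclideanSpace ℝ (Fin q) => u i) (h y hy a ha)

lemma isSmoothVectorFieldOn_iff {U : Opens M} {X : RoughVectorField n M} :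
    IsSmoothVectorFieldOn U X ↔ ∀ x ∈ U, ContMDiffAt (𝓡 n) (𝓡 n).tangent ∞
      (fun x => (⟨x, X x⟩ : TangentBundle (𝓡 n) M)) x :=
  ⟨fun h _ hx => h.contMDiffAt (U.isOpen.mem_nhds hx), fun h x hx => (h x hx).contMDiffWithinAt⟩

lemma mem_sheaf' (c : HaefligerCocycle n q M ι) {U : Opens M} {X : RoughVectorField n M} :
    X ∈ c.sheaf U ↔ ∀ x ∈ U, ContMDiffAt (𝓡 n) (𝓡 n).tangent ∞
      (fun x => (⟨x, X x⟩ : TangentBundle (𝓡 n) M)) x ∧ X x ∈ c.kernel x := by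
  rw [mem_sheaf, isSmoothVectorFieldOn_iff]
  exact ⟨fun h x hx => ⟨h.1 x hx, h.2 x hx⟩, fun h => ⟨fun x hx => (h x hx).1,
    fun x hx => (h x hx).2⟩⟩

theorem isTangentSubsheaf_sheaf (c : HaefligerCocycle n q M ι) : IsTangentSubsheaf c.sheaf where
  smooth U X hX := hX.1
  congr U X Y hX hXY := by
    rw [mem_sheaf'] at hX ⊢
    intro x hx
    have he : ∀ᶠ z in 𝓝 x, Y z = X z := by
      filter_upwards [U.isOpen.mem_nhds hx] with z hz using hXY z hz
    refine ⟨(hX x hx).1.congr_of_eventuallyEq (he.mono fun z hz => ?_), ?_⟩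
    · simp only [hz]
    · rw [hXY x hx]; exact (hX x hx).2
  zero_mem U := by
    rw [mem_sheaf']
    exact fun x _ => ⟨Bundle.contMDiffAt_zeroSection ℝ _, Submodule.zero_mem _⟩
  add_mem U X Y hX hY := by
    rw [mem_sheaf'] at hX hY ⊢
    exact fun x hx => ⟨(hX x hx).1.add_section (hY x hx).1,
      Submodule.add_mem _ (hX x hx).2 (hY x hx).2⟩
  smul_mem U X g hX hg := by
    rw [mem_sheaf'] at hX ⊢
    exact fun x hx => ⟨(hg.contMDiffAt (U.isOpen.mem_nhds hx)).smul_section (hX x hx).1,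
      Submodule.smul_mem _ _ (hX x hx).2⟩
  restrict U V hVU X hX := by
    rw [mem_sheaf'] at hX ⊢
    exact fun x hx => hX x (hVU hx)
  glue U X h := by
    rw [mem_sheaf']
    intro x hx
    obtain ⟨V, hxV, -, hXV⟩ := h x hx
    rw [mem_sheaf'] at hXV
    exact hXV x hxV

theorem isInvolutiveSheaf_sheaf (c : HaefligerCocycle n q M ι) : IsInvolutiveSheaf c.sheaf := by
  intro U X Y hX hY
  rw [mem_sheaf'] at hX hY ⊢
  intro x hx
  constructor
  · have : IsManifold (𝓡 n) (((⊤ : ℕ∞) : WithTop ℕ∞) + 1) M := ‹IsManifold (𝓡 n) ∞ M›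
    have hi : IsManifold (𝓡 n) (minSmoothness ℝ 2) M :=
      IsManifold.of_le (n := ∞) (by simp; exact ENat.LEInfty.out)
    exact (hX x hx).1.mlieBracket_vectorField (m := ⊤) (n := ⊤) (hY x hx).1 (by simp)
  · obtain ⟨a, ha⟩ := c.cover x
    have hU : ∀ᶠ z in 𝓝 x, z ∈ U ∧ z ∈ c.U a :=
      Filter.Eventually.and (U.isOpen.mem_nhds hx) ((c.U a).isOpen.mem_nhds ha)
    rw [c.mem_kernel ha]
    refine mfderiv_mlieBracket_eq_zero (hU.mono fun z hz => c.contMDiffAt_f hz.2)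
      (hX x hx).1 (hY x hx).1 (hU.mono fun z hz => ?_) (hU.mono fun z hz => ?_)
    · exact (c.mem_kernel hz.2).1 (hX z hz.1).2
    · exact (c.mem_kernel hz.2).1 (hY z hz.1).2

omit [IsManifold (𝓡 n) ∞ M] in
-- The two charts at `x` need not come from one of the given cocycles, but both are charts of the
-- common cocycle `d`, whose transition functions relate them.
theorem Equivalent.kernel_eq {c : HaefligerCocycle n q M ι} {c' : HaefligerCocycle n q M ι'}
    (h : c.Equivalent c') : c'.kernel = c.kernel := by
  obtain ⟨d, h1, -, h2, -⟩ := h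
  funext x
  obtain ⟨a, ha⟩ := c.cover x
  obtain ⟨b, hb⟩ := c'.cover x
  have ha' : x ∈ d.U (.inl a) := by rw [(h1 a).1]; exact ha
  have hb' : x ∈ d.U (.inr b) := by rw [(h2 b).1]; exact hb
  have ea : d.f (.inl a) =ᶠ[𝓝 x] c.f a :=
    (h1 a).2.eventuallyEq_of_mem ((c.U a).isOpen.mem_nhds ha)
  have eb : d.f (.inr b) =ᶠ[𝓝 x] c'.f b :=
    (h2 b).2.eventuallyEq_of_mem ((c'.U b).isOpen.mem_nhds hb)
  ext v
  rw [c.mem_kernel ha, c'.mem_kernel hb, ← ea.mfderiv_eq, ← eb.mfderiv_eq]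
  exact ⟨d.mfderiv_eq_zero_of_mem ha' hb', d.mfderiv_eq_zero_of_mem hb' ha'⟩

theorem Equivalent.sheaf_eq {c : HaefligerCocycle n q M ι} {c' : HaefligerCocycle n q M ι'}
    (h : c.Equivalent c') : c'.sheaf = c.sheaf := by
  funext U
  ext X
  rw [mem_sheaf, mem_sheaf, h.kernel_eq]

/-- Taking spans adds nothing: germs of sections can be added and scaled, so their values at `x`
already form a subspace. -/
theorem distribution_eq (c : HaefligerCocycle n q M ι) :
    c.distribution = generatedDistribution c.kernel := by
  funext x
  refine le_antisymm (Submodule.span_le.2 ?_) fun v hv => Submodule.subset_span ?_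
  · rintro _ ⟨U, hxU, X, hX, rfl⟩
    refine ⟨X, rfl, ?_⟩
    filter_upwards [U.isOpen.mem_nhds hxU] with z hz
    exact c.mem_sheaf'.1 hX z hz
  · obtain ⟨X, rfl, hX⟩ := hv
    obtain ⟨t, ht, hto, hxt⟩ := eventually_nhds_iff.1 hX
    exact ⟨⟨t, hto⟩, hxt, X, c.mem_sheaf'.2 ht, rfl⟩

end HaefligerCocycle

/-! ### Invariance under local flows -/

section LocalDiffeo

variable {E : Type*} [NormedAddCommGroup E] [NormedSpace ℝ E] {M : Type*} [TopologicalSpace M]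
  [ChartedSpace E M]
  {E' : Type*} [NormedAddCommGroup E'] [NormedSpace ℝ E'] {N : Type*} [TopologicalSpace N]
  [ChartedSpace E' N]
  {E'' : Type*} [NormedAddCommGroup E''] [NormedSpace ℝ E''] {P : Type*} [TopologicalSpace P]
  [ChartedSpace E'' P]

lemma OpenPartialHomeomorph.IsSmooth.trans {φ : OpenPartialHomeomorph M N}
    {ψ : OpenPartialHomeomorph N P} (hφ : φ.IsSmooth (E := E) (E' := E'))
    (hψ : ψ.IsSmooth (E := E') (E' := E'')) : (φ.trans ψ).IsSmooth (E := E) (E' := E'') := by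
  constructor
  · rw [φ.coe_trans, φ.trans_source]
    exact hψ.contMDiffOn.comp (hφ.contMDiffOn.mono inter_subset_left) fun x hx => hx.2
  · rw [φ.coe_trans_symm, φ.trans_target]
    exact hφ.contMDiffOn_symm.comp (hψ.contMDiffOn_symm.mono inter_subset_left) fun x hx => hx.2

lemma OpenPartialHomeomorph.isSmooth_of_contDiffOn {e : OpenPartialHomeomorph E E'}
    (h : ContDiffOn ℝ ∞ e e.source) (h' : ContDiffOn ℝ ∞ e.symm e.target) :
    e.IsSmooth (E := E) (E' := E') := ⟨h.contMDiffOn, h'.contMDiffOn⟩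

variable [IsManifold 𝓘(ℝ, E) ∞ M]

/-- The inverse function theorem in charts. Both manifolds have the same finite-dimensional model,
so an injective differential is invertible. -/
lemma exists_isSmooth_of_injective_mfderiv [FiniteDimensional ℝ E] {N : Type*}
    [TopologicalSpace N] [ChartedSpace E N] [IsManifold 𝓘(ℝ, E) ∞ N] {f : M → N} {x : M}
    (hf : ∀ᶠ z in 𝓝 x, ContMDiffAt 𝓘(ℝ, E) 𝓘(ℝ, E) ∞ f z)
    (hinj : ∀ v, mfderiv 𝓘(ℝ, E) 𝓘(ℝ, E) f x v = 0 → v = 0) :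
    ∃ φ : OpenPartialHomeomorph M N, φ.IsSmooth (E := E) (E' := E) ∧ x ∈ φ.source ∧
      EqOn φ f φ.source := by
  have : CompleteSpace E := FiniteDimensional.complete ℝ E
  set χ := chartAt E x
  set χ' := chartAt E (f x)
  have hχ : χ.IsSmooth (E := E) (E' := E) := isSmooth_chartAt x
  have hχ' : χ'.IsSmooth (E := E) (E' := E) := isSmooth_chartAt (f x)
  have hx : x ∈ χ.source := mem_chart_source E x
  have hfx : f x ∈ χ'.source := mem_chart_source E (f x)
  have hχx : χ x ∈ χ.target := χ.map_source hx
  have hfc : ContinuousAt f x := hf.self_of_nhds.continuousAt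
  obtain ⟨S, hS, hSo, hxS⟩ := eventually_nhds_iff.1
    (hf.and (hfc.eventually (χ'.open_source.mem_nhds hfx)))
  let O : Set E := χ.target ∩ χ.symm ⁻¹' S
  have hO : IsOpen O := χ.isOpen_inter_preimage_symm hSo
  let g : E → E := fun p => χ' (f (χ.symm p))
  have hxO : χ x ∈ O := ⟨hχx, by simpa [χ.left_inv hx] using hxS⟩
  have hgM : ∀ p ∈ O, ContMDiffAt 𝓘(ℝ, E) 𝓘(ℝ, E) ∞ g p := by
    intro p hp
    have h1 := hχ.contMDiffOn_symm.contMDiffAt (χ.open_target.mem_nhds hp.1)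
    have h2 := hχ'.contMDiffOn.contMDiffAt (χ'.open_source.mem_nhds (hS _ hp.2).2)
    exact h2.comp p ((hS _ hp.2).1.comp p h1)
  have hg : ContDiffOn ℝ ∞ g O := fun p hp => (hgM p hp).contDiffAt.contDiffWithinAt
  have hginj : Function.Injective (fderiv ℝ g (χ x)) := by
    refine (injective_iff_map_eq_zero (fderiv ℝ g (χ x))).2 fun v hv => ?_
    rw [← mfderiv_eq_fderiv] at hv
    have h1 := (hχ.mdifferentiable.mdifferentiableAt_symm hχx).hasMFDerivAt
    have e : χ.symm (χ x) = x := χ.left_inv hx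
    have h2 : HasMFDerivAt 𝓘(ℝ, E) 𝓘(ℝ, E) f (χ.symm (χ x))
        (mfderiv 𝓘(ℝ, E) 𝓘(ℝ, E) f x) := by
      rw [e]; exact (hf.self_of_nhds.mdifferentiableAt (by simp)).hasMFDerivAt
    have h3 : HasMFDerivAt 𝓘(ℝ, E) 𝓘(ℝ, E) χ' (f (χ.symm (χ x)))
        (mfderiv 𝓘(ℝ, E) 𝓘(ℝ, E) χ' (f x)) := by
      rw [e]; exact (hχ'.mdifferentiable.mdifferentiableAt hfx).hasMFDerivAt
    have h4 := (HasMFDerivAt.comp (g := χ') (χ x) h3 (h2.comp (χ x) h1)).mfderiv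
    have h5 : mfderiv 𝓘(ℝ, E) 𝓘(ℝ, E) χ' (f x) (mfderiv 𝓘(ℝ, E) 𝓘(ℝ, E) f x
        (mfderiv 𝓘(ℝ, E) 𝓘(ℝ, E) χ.symm (χ x) v)) = 0 := by
      have := DFunLike.congr_fun h4 v
      exact this.symm.trans hv
    have h6 := hinj _ (hχ'.mdifferentiable.mfderiv_injective hfx (h5.trans (map_zero _).symm))
    exact hχ.symm.mdifferentiable.mfderiv_injective (x := χ x) hχx (h6.trans (map_zero _).symm)
  let g' : E ≃L[ℝ] E := (LinearEquiv.ofInjectiveEndo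
    (fderiv ℝ g (χ x)).toLinearMap hginj).toContinuousLinearEquiv
  have hg' : HasFDerivAt g (g' : E →L[ℝ] E) (χ x) :=
    ((hgM _ hxO).contDiffAt.differentiableAt (by simp)).hasFDerivAt
  obtain ⟨e, he, hxe, heO, hes⟩ := hg.exists_openPartialHomeomorph hO hxO g' hg'
  have heS : e.IsSmooth (E := E) (E' := E) :=
    OpenPartialHomeomorph.isSmooth_of_contDiffOn (by rw [he]; exact hg.mono heO) hes
  have hgx : g (χ x) = χ' (f x) := by simp only [g, χ.left_inv hx]
  refine ⟨χ.trans (e.trans χ'.symm), hχ.trans (heS.trans hχ'.symm), ?_, ?_⟩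
  · refine ⟨hx, hxe, ?_⟩
    change e (χ x) ∈ χ'.target
    rw [he, hgx]
    exact χ'.map_source hfx
  · rintro z ⟨hz, hz', -⟩
    have hz2 := heO hz'
    change χ'.symm (e (χ z)) = f z
    rw [he]
    change χ'.symm (χ' (f (χ.symm (χ z)))) = f z
    have hz3 : χ.symm (χ z) = z := χ.left_inv hz
    have hzS : z ∈ S := (congrArg (· ∈ S) hz3).mp hz2.2
    rw [hz3, χ'.left_inv (hS _ hzS).2]

omit [IsManifold 𝓘(ℝ, E) ∞ M] in
lemma OpenPartialHomeomorph.IsSmooth.mpullback_symm_apply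
    {φ : OpenPartialHomeomorph M N}
    (hφ : φ.IsSmooth (E := E) (E' := E')) (X : ∀ x : M, TangentSpace 𝓘(ℝ, E) x) {z : M}
    (hz : z ∈ φ.source) : VectorField.mpullback 𝓘(ℝ, E') 𝓘(ℝ, E) φ.symm X (φ z) =
      mfderiv 𝓘(ℝ, E) 𝓘(ℝ, E') φ z (X z) := by
  rw [VectorField.mpullback_apply]
  obtain ⟨e, he⟩ := hφ.symm.isInvertible_mfderiv (φ.map_source hz)
  rw [← he, ContinuousLinearMap.inverse_equiv]
  refine (ContinuousLinearEquiv.symm_apply_eq e).2 ?_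
  have h1 := DFunLike.congr_fun (hφ.mdifferentiable.symm_comp_deriv hz) (X z)
  have h2 : e (mfderiv 𝓘(ℝ, E) 𝓘(ℝ, E') φ z (X z)) =
      mfderiv 𝓘(ℝ, E') 𝓘(ℝ, E) φ.symm (φ z) (mfderiv 𝓘(ℝ, E) 𝓘(ℝ, E') φ z (X z)) :=
    DFunLike.congr_fun he _
  have h3 := congrArg (fun m => (id (X m) : E)) (φ.left_inv hz)
  exact h3.trans (h2.trans h1).symm

end LocalDiffeo

/-! ### Local flows preserve the kernel and the distribution -/

section LocalFlow

variable {n q : ℕ} {M : Type u} [TopologicalSpace M] [ChartedSpace (EuclideanSpace ℝ (Fin n)) M]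
  [IsManifold (𝓡 n) ∞ M] {ι : Type v}

namespace IsLocalFlow

variable {U : Opens M} {X : RoughVectorField n M} {W : Set (ℝ × M)} {Φ : ℝ × M → M}

omit [IsManifold (𝓡 n) ∞ M] in
lemma contMDiffAt (h : IsLocalFlow U X W Φ) {p : ℝ × M} (hp : p ∈ W) :
    ContMDiffAt (𝓘(ℝ, ℝ).prod (𝓡 n)) (𝓡 n) ∞ Φ p :=
  h.smooth.contMDiffAt (h.isOpen.mem_nhds hp)

omit [IsManifold (𝓡 n) ∞ M] in
lemma contMDiffAt_right (h : IsLocalFlow U X W Φ) {s : ℝ} {y : M} (hp : (s, y) ∈ W) :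
    ContMDiffAt (𝓡 n) (𝓡 n) ∞ (fun z => Φ (s, z)) y :=
  (h.contMDiffAt hp).comp y (contMDiffAt_const.prodMk contMDiffAt_id)

omit [IsManifold (𝓡 n) ∞ M] in
lemma eventually_mem_right (h : IsLocalFlow U X W Φ) {s : ℝ} {y : M} (hp : (s, y) ∈ W) :
    ∀ᶠ z in 𝓝 y, (s, z) ∈ W :=
  (Continuous.prodMk_right s).continuousAt.preimage_mem_nhds (h.isOpen.mem_nhds hp)

omit [IsManifold (𝓡 n) ∞ M] in
lemma hasMFDerivAt_left (h : IsLocalFlow U X W Φ) {s : ℝ} {y : M} (hp : (s, y) ∈ W) :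
    HasMFDerivAt 𝓘(ℝ, ℝ) (𝓡 n) (fun t => Φ (t, y)) s
      ((1 : ℝ →L[ℝ] ℝ).smulRight (X (Φ (s, y)))) :=
  (h.integral y s hp).hasMFDerivAt
    ((Continuous.prodMk_left y).continuousAt.preimage_mem_nhds (h.isOpen.mem_nhds hp))

omit [IsManifold (𝓡 n) ∞ M] in
-- `f` is constant along trajectories while they stay in `O`. A product neighbourhood of `(s₀, y)`
-- makes the time interval uniform in the starting point, which gives equality of germs at `y`.
lemma eventually_eq_of_mfderiv_eq_zero (h : IsLocalFlow U X W Φ) {G : Type*}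
    [NormedAddCommGroup G] [NormedSpace ℝ G] {f : M → G} {O : Set M} (hO : IsOpen O)
    (hf : ∀ z ∈ O, MDifferentiableAt (𝓡 n) 𝓘(ℝ, G) f z)
    (hfX : ∀ z ∈ O, z ∈ U → mfderiv (𝓡 n) 𝓘(ℝ, G) f z (X z) = 0) {s₀ : ℝ} {y : M}
    (hW : (s₀, y) ∈ W) (hsO : Φ (s₀, y) ∈ O) :
    ∀ᶠ s in 𝓝 s₀, (fun z => f (Φ (s, z))) =ᶠ[𝓝 y] fun z => f (Φ (s₀, z)) := by
  have hev : ∀ᶠ p in 𝓝 (s₀, y), p ∈ W ∧ Φ p ∈ O :=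
    Filter.Eventually.and (h.isOpen.mem_nhds hW)
      ((h.contMDiffAt hW).continuousAt.preimage_mem_nhds (hO.mem_nhds hsO))
  rw [nhds_prod_eq] at hev
  obtain ⟨A, hA, B, hB, hAB⟩ := eventually_prod_iff.1 hev
  obtain ⟨a, b, hab, hsub⟩ := mem_nhds_iff_exists_Ioo_subset.1 hA
  filter_upwards [Ioo_mem_nhds hab.1 hab.2] with s hs
  filter_upwards [hB] with z hz
  have hd : ∀ t ∈ Ioo a b, HasFDerivAt (fun t => f (Φ (t, z))) (0 : ℝ →L[ℝ] G) t := by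
    intro t ht
    obtain ⟨hp, hpO⟩ := hAB (hsub ht) hz
    have h1 := (hf _ hpO).hasMFDerivAt.comp t (h.hasMFDerivAt_left hp)
    have h2 : (mfderiv (𝓡 n) 𝓘(ℝ, G) f (Φ (t, z))).comp
        ((1 : ℝ →L[ℝ] ℝ).smulRight (X (Φ (t, z)))) = 0 := by
      refine ContinuousLinearMap.ext fun r => ?_
      refine (map_smul (mfderiv (𝓡 n) 𝓘(ℝ, G) f (Φ (t, z))) r (X (Φ (t, z)))).trans ?_
      rw [hfX _ hpO (h.mapsTo _ hp)]
      exact smul_zero r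
    have h3 : HasMFDerivAt 𝓘(ℝ, ℝ) 𝓘(ℝ, G) (fun t => f (Φ (t, z))) t (0 : ℝ →L[ℝ] G) :=
      h1.congr_mfderiv h2
    exact h3.hasFDerivAt
  exact isOpen_Ioo.is_const_of_fderiv_eq_zero isPreconnected_Ioo
    (fun t ht => (hd t ht).differentiableAt.differentiableWithinAt)
    (fun t ht => (hd t ht).fderiv) hs hab

/-- The vector `dΦ_s v` lies in `K` exactly when `d(f_b ∘ Φ_s) v = 0`, and the germ of `f_b ∘ Φ_s`
at `y` does not change for `s` near `s₀`. -/
lemma eventually_mem_kernel_iff (c : HaefligerCocycle n q M ι) (hX : X ∈ c.sheaf U)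
    (h : IsLocalFlow U X W Φ) {s₀ : ℝ} {y : M} (hW : (s₀, y) ∈ W) :
    ∀ᶠ s in 𝓝 s₀, ∀ v, mfderiv (𝓡 n) (𝓡 n) (fun z => Φ (s, z)) y v ∈ c.kernel (Φ (s, y)) ↔
      mfderiv (𝓡 n) (𝓡 n) (fun z => Φ (s₀, z)) y v ∈ c.kernel (Φ (s₀, y)) := by
  obtain ⟨b, hb⟩ := c.cover (Φ (s₀, y))
  have hfb : ∀ z ∈ (c.U b : Set M), MDifferentiableAt (𝓡 n) (𝓡 q) (c.f b) z :=
    fun z hz => (c.contMDiffAt_f hz).mdifferentiableAt (by simp)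
  have hev := h.eventually_eq_of_mfderiv_eq_zero (f := c.f b) (c.U b).isOpen hfb
    (fun z hz hzU => (c.mem_kernel hz).1 ((c.mem_sheaf.1 hX).2 z hzU)) hW hb
  have hcont : ContinuousAt (fun s : ℝ => (s, y)) s₀ := (Continuous.prodMk_left y).continuousAt
  have hWev : ∀ᶠ s in 𝓝 s₀, (s, y) ∈ W ∧ Φ (s, y) ∈ c.U b :=
    hcont.eventually (Filter.Eventually.and (h.isOpen.mem_nhds hW)
      ((h.contMDiffAt hW).continuousAt.preimage_mem_nhds ((c.U b).isOpen.mem_nhds hb)))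
  have key : ∀ s, (s, y) ∈ W → Φ (s, y) ∈ c.U b → ∀ v,
      mfderiv (𝓡 n) (𝓡 n) (fun z => Φ (s, z)) y v ∈ c.kernel (Φ (s, y)) ↔
        mfderiv (𝓡 n) (𝓡 q) (fun z => c.f b (Φ (s, z))) y v = 0 := by
    intro s hs hsb v
    have h1 := mfderiv_comp (g := c.f b) (f := fun z => Φ (s, z)) y (hfb _ hsb)
      ((h.contMDiffAt_right hs).mdifferentiableAt (by simp))
    rw [c.mem_kernel hsb]
    have h2 := DFunLike.congr_fun h1 v
    exact iff_of_eq (congrArg (fun u : EuclideanSpace ℝ (Fin q) => u = 0) h2.symm)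
  filter_upwards [hev, hWev] with s hs hsW v
  rw [key s hsW.1 hsW.2, key s₀ hW hb, hs.mfderiv_eq]
  exact Iff.rfl

/-- In charts around `y` and `Φ (s₀, y)` the flow solves an autonomous equation in a vector space,
where `eventually_fderiv_flow_eq_zero_iff` applies. -/
lemma eventually_mfderiv_eq_zero_iff (hX : IsSmoothVectorFieldOn U X)
    (h : IsLocalFlow U X W Φ) {s₀ : ℝ} {y : M} (hW : (s₀, y) ∈ W) :
    ∀ᶠ s in 𝓝 s₀, ∀ v, mfderiv (𝓡 n) (𝓡 n) (fun z => Φ (s, z)) y v = 0 ↔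
      mfderiv (𝓡 n) (𝓡 n) (fun z => Φ (s₀, z)) y v = 0 := by
  set E := EuclideanSpace ℝ (Fin n)
  set χ := chartAt E y
  set χ' := chartAt E (Φ (s₀, y))
  have hχ : χ.IsSmooth (E := E) (E' := E) := isSmooth_chartAt y
  have hχ' : χ'.IsSmooth (E := E) (E' := E) := isSmooth_chartAt (Φ (s₀, y))
  have hy : y ∈ χ.source := mem_chart_source E y
  have hy' : Φ (s₀, y) ∈ χ'.source := mem_chart_source E (Φ (s₀, y))
  have hχy : χ y ∈ χ.target := χ.map_source hy
  have hχχ : χ.symm (χ y) = y := χ.left_inv hy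
  let j : ℝ × E → ℝ × M := fun q => (q.1, χ.symm q.2)
  let O : Set (ℝ × M) := W ∩ Φ ⁻¹' χ'.source
  have hO : IsOpen O := h.smooth.continuousOn.isOpen_inter_preimage h.isOpen χ'.open_source
  have hjy : j (s₀, χ y) = (s₀, y) := Prod.ext rfl hχχ
  have hjc : ContinuousAt j (s₀, χ y) :=
    continuousAt_fst.prodMk (ContinuousAt.comp (f := Prod.snd) (g := χ.symm)
      (χ.symm.continuousAt hχy) continuousAt_snd)
  have hev : ∀ᶠ q in 𝓝 (s₀, χ y), q.2 ∈ χ.target ∧ j q ∈ O := by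
    refine Filter.Eventually.and
      (continuousAt_snd.preimage_mem_nhds (χ.open_target.mem_nhds hχy))
      (hjc.preimage_mem_nhds (hO.mem_nhds ?_))
    rw [hjy]; exact ⟨hW, hy'⟩
  let Ψ : ℝ × E → E := fun q => χ' (Φ (j q))
  let V : E → E := VectorField.mpullback (𝓡 n) (𝓡 n) χ'.symm X
  have hΨ : ∀ᶠ q in 𝓝 (s₀, χ y), ContDiffAt ℝ ∞ Ψ q := by
    filter_upwards [hev] with q ⟨hq, hqO⟩
    have h1 : ContMDiffAt 𝓘(ℝ, ℝ × E) (𝓘(ℝ, ℝ).prod (𝓡 n)) ∞ j q := by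
      refine contDiff_fst.contMDiff.contMDiffAt.prodMk ?_
      exact ContMDiffAt.comp q (g := χ.symm) (f := fun q : ℝ × E => q.2)
        (hχ.contMDiffOn_symm.contMDiffAt (χ.open_target.mem_nhds hq))
        contDiff_snd.contMDiff.contMDiffAt
    have h2 := (hχ'.contMDiffOn.contMDiffAt (χ'.open_source.mem_nhds hqO.2))
    exact (h2.comp q ((h.contMDiffAt hqO.1).comp q h1)).contDiffAt
  have hV : ContDiffAt ℝ ∞ V (Ψ (s₀, χ y)) := by
    have e1 : Ψ (s₀, χ y) = χ' (Φ (s₀, y)) := by simp only [Ψ, hjy]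
    have e2 : χ'.symm (χ' (Φ (s₀, y))) = Φ (s₀, y) := χ'.left_inv hy'
    rw [e1]
    have hmem := χ'.map_source hy'
    refine contMDiffAt_vectorSpace_iff_contDiffAt.1
      (ContMDiffAt.mpullback_vectorField_preimage (m := ∞) (n := ∞) ?_
      (hχ'.contMDiffOn_symm.contMDiffAt (χ'.open_target.mem_nhds hmem))
      (hχ'.symm.isInvertible_mfderiv hmem) le_rfl)
    rw [e2]
    exact hX.contMDiffAt (U.isOpen.mem_nhds (h.mapsTo _ hW))
  have hΨV : ∀ᶠ q in 𝓝 (s₀, χ y), HasDerivAt (fun s => Ψ (s, q.2)) (V (Ψ q)) q.1 := by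
    filter_upwards [hev] with q ⟨hq, hqO⟩
    have h1 := (hχ'.mdifferentiable.mdifferentiableAt hqO.2).hasMFDerivAt.comp q.1
      (h.hasMFDerivAt_left (s := q.1) (y := χ.symm q.2) hqO.1)
    have h2 : HasFDerivAt (fun s => Ψ (s, q.2)) (_ : ℝ →L[ℝ] E) q.1 :=
      hasMFDerivAt_iff_hasFDerivAt.1 h1
    refine h2.hasDerivAt.congr_deriv ?_
    refine Eq.trans ?_ (hχ'.mpullback_symm_apply X hqO.2).symm
    exact congrArg (mfderiv (𝓡 n) (𝓡 n) χ' (Φ (j q))) (one_smul ℝ (X (Φ (j q))))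
  have hmain := eventually_fderiv_flow_eq_zero_iff hΨ hV hΨV
  have hcont : ContinuousAt (fun s : ℝ => (s, χ y)) s₀ := (Continuous.prodMk_left _).continuousAt
  have key : ∀ s, j (s, χ y) ∈ O → ∀ v : TangentSpace (𝓡 n) y,
      fderiv ℝ (fun p => Ψ (s, p)) (χ y) (mfderiv (𝓡 n) (𝓡 n) χ y v) = 0 ↔
        mfderiv (𝓡 n) (𝓡 n) (fun z => Φ (s, z)) y v = 0 := by
    intro s hs v
    have hs' : (s, y) ∈ O := by rwa [show j (s, χ y) = (s, y) from Prod.ext rfl hχχ] at hs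
    have e1 : (fun p => Ψ (s, p)) ∘ χ =ᶠ[𝓝 y] fun z => χ' (Φ (s, z)) := by
      filter_upwards [χ.open_source.mem_nhds hy] with z hz
      simp only [Function.comp, Ψ, j, χ.left_inv hz]
    have hD : ContMDiffAt (𝓡 n) (𝓡 n) ∞ (fun z => χ' (Φ (s, z))) y :=
      (hχ'.contMDiffOn.contMDiffAt (χ'.open_source.mem_nhds hs'.2)).comp y
        (h.contMDiffAt_right hs'.1)
    have hD2 : MDifferentiableAt (𝓡 n) (𝓡 n) (fun p => Ψ (s, p)) (χ y) := by
      have h1 := hχ.contMDiffOn_symm.contMDiffAt (χ.open_target.mem_nhds hχy)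
      have h2 : ContMDiffAt (𝓡 n) (𝓡 n) ∞ (fun z => χ' (Φ (s, z))) (χ.symm (χ y)) := by
        rw [hχχ]; exact hD
      exact (h2.comp (χ y) h1).mdifferentiableAt (by simp)
    have h1 := mfderiv_comp y hD2 (hχ.mdifferentiable.mdifferentiableAt hy)
    have h2 := mfderiv_comp (g := χ') (f := fun z => Φ (s, z)) y
      (hχ'.mdifferentiable.mdifferentiableAt hs'.2)
      ((h.contMDiffAt_right hs'.1).mdifferentiableAt (by simp))
    rw [e1.mfderiv_eq, mfderiv_eq_fderiv] at h1
    have h3 : fderiv ℝ (fun p => Ψ (s, p)) (χ y) (mfderiv (𝓡 n) (𝓡 n) χ y v) =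
        mfderiv (𝓡 n) (𝓡 n) χ' (Φ (s, y)) (mfderiv (𝓡 n) (𝓡 n) (fun z => Φ (s, z)) y v) :=
      DFunLike.congr_fun (h1.symm.trans h2) v
    constructor
    · intro h0
      exact hχ'.mdifferentiable.mfderiv_injective hs'.2
        ((h3.symm.trans h0).trans (map_zero _).symm)
    · intro h0
      rw [h3, h0]
      exact map_zero _
  filter_upwards [hmain, hcont.eventually hev] with s hs hsO v
  exact (key s hsO.2 v).symm.trans ((hs _).trans (key s₀ hev.self_of_nhds.2 v))

omit [IsManifold (𝓡 n) ∞ M] in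
lemma mfderiv_zero_apply (h : IsLocalFlow U X W Φ) {y : M} (hW : ((0 : ℝ), y) ∈ W)
    (v : TangentSpace (𝓡 n) y) :
    mfderiv (𝓡 n) (𝓡 n) (fun z => Φ (0, z)) y v = (id v : EuclideanSpace ℝ (Fin n)) := by
  have e : (fun z => Φ (0, z)) =ᶠ[𝓝 y] id := by
    filter_upwards [h.eventually_mem_right hW] with z hz using h.zero z hz
  rw [e.mfderiv_eq, mfderiv_id]
  rfl

theorem mem_kernel_iff (c : HaefligerCocycle n q M ι) (hX : X ∈ c.sheaf U)
    (h : IsLocalFlow U X W Φ) {t : ℝ} {y : M} (hW : (t, y) ∈ W) :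
    (∀ v, v ∈ c.kernel y ↔
      mfderiv (𝓡 n) (𝓡 n) (fun z => Φ (t, z)) y v ∈ c.kernel (Φ (t, y))) ∧
    ∀ v, mfderiv (𝓡 n) (𝓡 n) (fun z => Φ (t, z)) y v = 0 → v = 0 := by
  -- An equivalence relation between times that holds between any time of the segment and all nearby
  -- ones. By connectedness it relates `0` to `t`, and `Φ_0` is the identity near `y`.
  let P : ℝ → ℝ → Prop := fun s s' =>
    (∀ v, mfderiv (𝓡 n) (𝓡 n) (fun z => Φ (s, z)) y v ∈ c.kernel (Φ (s, y)) ↔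
      mfderiv (𝓡 n) (𝓡 n) (fun z => Φ (s', z)) y v ∈ c.kernel (Φ (s', y))) ∧
    ∀ v, mfderiv (𝓡 n) (𝓡 n) (fun z => Φ (s, z)) y v = 0 ↔
      mfderiv (𝓡 n) (𝓡 n) (fun z => Φ (s', z)) y v = 0
  have hsymm : ∀ s s', P s s' → P s' s := fun s s' h =>
    ⟨fun v => (h.1 v).symm, fun v => (h.2 v).symm⟩
  have h0 : ((0 : ℝ), y) ∈ W := h.segment t y hW 0 left_mem_uIcc
  have hP : P 0 t := by
    refine isPreconnected_uIcc.induction₂ P (fun s hs => ?_) (fun s s' s'' _ _ _ h1 h2 =>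
      ⟨fun v => (h1.1 v).trans (h2.1 v), fun v => (h1.2 v).trans (h2.2 v)⟩)
      (fun s s' _ _ => hsymm s s') left_mem_uIcc right_mem_uIcc
    have hsW := h.segment t y hW s hs
    have := (h.eventually_mem_kernel_iff c hX hsW).and
      (h.eventually_mfderiv_eq_zero_iff (c.mem_sheaf.1 hX).1 hsW)
    exact nhdsWithin_le_nhds (this.mono fun s' hs' => hsymm _ _ hs')
  constructor
  · intro v
    rw [← hP.1 v]
    have e := h.mfderiv_zero_apply h0 v
    refine (mem_submodule_congr_base (D := c.kernel) (h.zero y h0).symm).trans ?_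
    exact iff_of_eq (congrArg (· ∈ c.kernel (Φ (0, y))) e.symm)
  · intro v hv
    have e := h.mfderiv_zero_apply h0 v
    exact e.symm.trans ((hP.2 v).2 hv)

end IsLocalFlow

/-- By `mem_kernel_iff`, applied at all points near `y`, `Φ_t` is there a local diffeomorphism
matching `K` with `K`; naturality carries this over to `Δ`. -/
theorem HaefligerCocycle.isFlowInvariant_distribution (c : HaefligerCocycle n q M ι) :
    IsFlowInvariant c.sheaf c.distribution := by
  intro U X hX W Φ h t y hW
  rw [c.distribution_eq]
  have hev := h.eventually_mem_right hW
  obtain ⟨φ, hφ, hyφ, heq⟩ := exists_isSmooth_of_injective_mfderiv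
    (hev.mono fun z hz => h.contMDiffAt_right hz) (h.mem_kernel_iff c hX hW).2
  have hφe : ∀ z ∈ φ.source, φ =ᶠ[𝓝 z] fun z => Φ (t, z) :=
    fun z hz => heq.eventuallyEq_of_mem (φ.open_source.mem_nhds hz)
  have hφy : φ y = Φ (t, y) := heq hyφ
  have hK : ∀ᶠ z in 𝓝 y, ∀ v, v ∈ c.kernel z ↔
      mfderiv (𝓡 n) (𝓡 n) φ z v ∈ c.kernel (φ z) := by
    filter_upwards [hev, φ.open_source.mem_nhds hyφ] with z hz hzφ v
    rw [((h.mem_kernel_iff c hX hz).1 v), (hφe z hzφ).mfderiv_eq]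
    exact mem_submodule_congr_base (D := c.kernel) (heq hzφ).symm
  have key : ∀ v, v ∈ generatedDistribution c.kernel y ↔
      mfderiv (𝓡 n) (𝓡 n) (fun z => Φ (t, z)) y v ∈
        generatedDistribution c.kernel (Φ (t, y)) := by
    intro v
    rw [hφ.mem_generatedDistribution_iff hyφ hK v, (hφe y hyφ).mfderiv_eq]
    exact mem_submodule_congr_base (D := generatedDistribution c.kernel) hφy
  have hsurj : Function.Surjective (mfderiv (𝓡 n) (𝓡 n) (fun z => Φ (t, z)) y) := by
    have := hφ.mdifferentiable.mfderiv_surjective hyφ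
    rwa [(hφe y hyφ).mfderiv_eq] at this
  ext u
  rw [Submodule.mem_map]
  constructor
  · rintro ⟨v, hv, rfl⟩
    exact (key v).1 hv
  · intro hu
    obtain ⟨v, rfl⟩ := hsurj u
    exact ⟨v, (key v).2 hu, rfl⟩

end LocalFlow

/-! ### Foliated charts -/

section Foliated

variable {n q : ℕ} {M : Type u} [TopologicalSpace M] [ChartedSpace (EuclideanSpace ℝ (Fin n)) M]
  [IsManifold (𝓡 n) ∞ M] {ι : Type v}

/-- A chart `φ` with values in `ℝ^k × ℝ^m` in which the rank of `Δ` only depends on the second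
coordinate, and in which `Δ` is tangent to the first factor where its rank is `k`. -/
structure FoliatedChart (Δ : TangentDistribution n M) (k : ℕ) where
  m : ℕ
  φ : OpenPartialHomeomorph M (EuclideanSpace ℝ (Fin k) × EuclideanSpace ℝ (Fin m))
  isSmooth : φ.IsSmooth (E := EuclideanSpace ℝ (Fin n))
    (E' := EuclideanSpace ℝ (Fin k) × EuclideanSpace ℝ (Fin m))
  finrank_eq : ∀ z ∈ φ.source, ∀ z' ∈ φ.source, (φ z).2 = (φ z').2 →
    Module.finrank ℝ (Δ z) = Module.finrank ℝ (Δ z')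
  mem_iff : ∀ z ∈ φ.source, Module.finrank ℝ (Δ z) = k → ∀ v, v ∈ Δ z ↔
    ContinuousLinearMap.snd ℝ (EuclideanSpace ℝ (Fin k)) (EuclideanSpace ℝ (Fin m))
      (mfderiv (𝓡 n) 𝓘(ℝ, EuclideanSpace ℝ (Fin k) × EuclideanSpace ℝ (Fin m)) φ z v) = 0

/-! ### The flat model: kernels that depend on the second factor only -/

section FlatKernel

variable {P Q G : Type*} [NormedAddCommGroup P] [NormedSpace ℝ P] [NormedAddCommGroup Q]
  [NormedSpace ℝ Q] [NormedAddCommGroup G] [NormedSpace ℝ G]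

/-- The kernel of the differential of `g ∘ Prod.snd`. -/
noncomputable def sndKernel (P : Type*) [NormedAddCommGroup P] [NormedSpace ℝ P] (g : Q → G)
    (p : P × Q) : Submodule ℝ (TangentSpace 𝓘(ℝ, P × Q) p) :=
  LinearMap.ker ((fderiv ℝ g p.2).comp (ContinuousLinearMap.snd ℝ P Q)).toLinearMap

lemma mem_sndKernel {g : Q → G} {p : P × Q} {v : P × Q} :
    (id v : TangentSpace 𝓘(ℝ, P × Q) p) ∈ sndKernel P g p ↔ fderiv ℝ g p.2 v.2 = 0 := Iff.rfl

lemma mem_generatedDistribution_flat_iff {E : Type*} [NormedAddCommGroup E] [NormedSpace ℝ E]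
    {K : ∀ x : E, Submodule ℝ (TangentSpace 𝓘(ℝ, E) x)} {x v : E} :
    (id v : TangentSpace 𝓘(ℝ, E) x) ∈ generatedDistribution K x ↔
      ∃ X : E → E, X x = v ∧ ∀ᶠ z in 𝓝 x, ContDiffAt ℝ ∞ X z ∧
        (id (X z) : TangentSpace 𝓘(ℝ, E) z) ∈ K z := by
  constructor
  · rintro ⟨X, hX, h⟩
    exact ⟨X, hX, h.mono fun z hz => ⟨contMDiffAt_vectorSpace_iff_contDiffAt.1 hz.1, hz.2⟩⟩
  · rintro ⟨X, hX, h⟩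
    exact ⟨X, hX, h.mono fun z hz => ⟨contMDiffAt_vectorSpace_iff_contDiffAt.2 hz.1, hz.2⟩⟩

/-- Translation by `p - p'` moves the first factor only, so it preserves the kernel and carries
sections near `p` to sections near `p'`. -/
lemma mem_generatedDistribution_sndKernel_congr {g : Q → G} {p p' : P × Q} (h : p.2 = p'.2)
    {v : P × Q}
    (hv : (id v : TangentSpace 𝓘(ℝ, P × Q) p) ∈ generatedDistribution (sndKernel P g) p) :
    (id v : TangentSpace 𝓘(ℝ, P × Q) p') ∈ generatedDistribution (sndKernel P g) p' := by
  obtain ⟨X, rfl, hX⟩ := mem_generatedDistribution_flat_iff.1 hv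
  refine mem_generatedDistribution_flat_iff.2 ⟨fun z => X (z + (p - p')), by simp, ?_⟩
  have ht : Tendsto (fun z => z + (p - p')) (𝓝 p') (𝓝 p) := by
    have : ContinuousAt (fun z => z + (p - p')) p' := by fun_prop
    simpa [ContinuousAt] using this
  filter_upwards [ht.eventually hX] with z hz
  refine ⟨hz.1.comp z (by fun_prop), mem_sndKernel.2 ?_⟩
  have := mem_sndKernel.1 hz.2
  simpa [h] using this

lemma inl_mem_generatedDistribution_sndKernel {g : Q → G} (p : P × Q) (t : P) :
    (id (t, 0) : TangentSpace 𝓘(ℝ, P × Q) p) ∈ generatedDistribution (sndKernel P g) p :=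
  mem_generatedDistribution_flat_iff.2 ⟨fun _ => (t, 0), rfl, Eventually.of_forall fun _ =>
    ⟨contDiffAt_const, mem_sndKernel.2 (map_zero _)⟩⟩

end FlatKernel

/-- Straightening sections whose values at `x` form a basis of `Δ_x` makes `f_a` a function of the
second coordinate, so that `Δ` becomes the distribution generated by the flat model. -/
theorem HaefligerCocycle.exists_foliatedChart (c : HaefligerCocycle n q M ι) {k : ℕ} {x : M}
    (hk : Module.finrank ℝ (c.distribution x) = k) :
    ∃ C : FoliatedChart c.distribution k, x ∈ C.φ.source := by
  obtain ⟨a, ha⟩ := c.cover x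
  set E := EuclideanSpace ℝ (Fin n) with hE
  let P := EuclideanSpace ℝ (Fin k)
  set χ := chartAt E x
  have hχ : χ.IsSmooth (E := E) (E' := E) := isSmooth_chartAt x
  have hx : x ∈ χ.source := mem_chart_source E x
  let g : E → EuclideanSpace ℝ (Fin q) := fun p => c.f a (χ.symm p)
  let O₀ : Set E := χ.target ∩ χ.symm ⁻¹' (c.U a)
  have hO₀ : IsOpen O₀ := χ.isOpen_inter_preimage_symm (c.U a).isOpen
  have hxO₀ : χ x ∈ O₀ := ⟨χ.map_source hx, by simpa [χ.left_inv hx] using ha⟩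
  have hg : ContDiffOn ℝ ∞ g O₀ := fun p hp =>
    ((c.contMDiffAt_f hp.2).comp p (hχ.contMDiffOn_symm.contMDiffAt
      (χ.open_target.mem_nhds hp.1))).contDiffAt.contDiffWithinAt
  have hd : ∀ p ∈ O₀, DifferentiableAt ℝ g p := fun p hp =>
    (hg.contDiffAt (hO₀.mem_nhds hp)).differentiableAt (by simp)
  let K : ∀ p : E, Submodule ℝ (TangentSpace 𝓘(ℝ, E) p) :=
    fun p => LinearMap.ker (fderiv ℝ g p).toLinearMap
  have hUa : ∀ z ∈ χ.source, χ z ∈ O₀ → z ∈ c.U a := by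
    intro z hz hzO
    have h := hzO.2
    rwa [mem_preimage, χ.left_inv hz] at h
  have hK : ∀ᶠ z in 𝓝 x, ∀ v, v ∈ c.kernel z ↔ mfderiv 𝓘(ℝ, E) 𝓘(ℝ, E) χ z v ∈ K (χ z) := by
    filter_upwards [χ.open_source.mem_nhds hx,
      (χ.continuousAt hx).preimage_mem_nhds (hO₀.mem_nhds hxO₀)] with z hz hzO v
    rw [c.mem_kernel (hUa z hz hzO)]
    have e : c.f a =ᶠ[𝓝 z] g ∘ χ := by
      filter_upwards [χ.open_source.mem_nhds hz] with z' hz'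
      simp only [g, Function.comp, χ.left_inv hz']
    have h1 := mfderiv_comp z (hd _ hzO).mdifferentiableAt (hχ.mdifferentiable.mdifferentiableAt hz)
    rw [← e.mfderiv_eq, mfderiv_eq_fderiv] at h1
    have h2 := DFunLike.congr_fun h1 v
    exact iff_of_eq (congrArg (fun u : EuclideanSpace ℝ (Fin q) => u = 0) h2)
  have hfin : ∀ z : M, FiniteDimensional ℝ (TangentSpace (𝓡 n) z) :=
    fun z => inferInstanceAs (FiniteDimensional ℝ E)
  let b : Module.Basis (Fin k) ℝ (c.distribution x) := Module.finBasisOfFinrankEq ℝ _ hk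
  have hb : ∀ i, ∃ X : E → E, X (χ x) = mfderiv 𝓘(ℝ, E) 𝓘(ℝ, E) χ x (b i) ∧
      ∀ᶠ z in 𝓝 (χ x), ContDiffAt ℝ ∞ X z ∧ fderiv ℝ g z (X z) = 0 := by
    intro i
    have h1 : ((b i : c.distribution x) : TangentSpace (𝓡 n) x) ∈
        generatedDistribution c.kernel x := by
      rw [← c.distribution_eq]; exact (b i).2
    exact mem_generatedDistribution_flat_iff.1 ((hχ.mem_generatedDistribution_iff hx hK _).1 h1)
  choose X hXb hX using hb
  obtain ⟨O, hOsub, hO, hxO⟩ := mem_nhds_iff.1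
    (Filter.inter_mem (hO₀.mem_nhds hxO₀) (eventually_all.2 hX))
  have hli : LinearIndependent ℝ fun i => X i (χ x) := by
    have h1 : LinearIndependent ℝ fun i => ((b i : c.distribution x) : TangentSpace (𝓡 n) x) :=
      b.linearIndependent.map' (c.distribution x).subtype (Submodule.ker_subtype _)
    have h2 := h1.map' (mfderiv 𝓘(ℝ, E) 𝓘(ℝ, E) χ x).toLinearMap
      (hχ.mdifferentiable.ker_mfderiv_eq_bot hx)
    have h3 : (fun i => X i (χ x)) =
        fun i => (mfderiv 𝓘(ℝ, E) 𝓘(ℝ, E) χ x) (b i) := funext hXb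
    rw [h3]
    exact h2
  obtain ⟨m, e, g', hxe, heO, hes, hes', hg'd, hg'⟩ := exists_straightening hO hxO
    (hg.mono fun p hp => (hOsub hp).1) X
    (fun i p hp => ((hOsub hp).2 i).1.contDiffWithinAt) (fun i p hp => ((hOsub hp).2 i).2) hli
  let Q := EuclideanSpace ℝ (Fin m)
  have heS : e.IsSmooth (E := P × Q) (E' := E) :=
    OpenPartialHomeomorph.isSmooth_of_contDiffOn hes hes'
  let φ := χ.trans e.symm
  have hφ : φ.IsSmooth (E := E) (E' := P × Q) := hχ.trans heS.symm
  have hφsource : ∀ z ∈ φ.source, z ∈ χ.source ∧ χ z ∈ e.target := fun z hz => hz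
  have hKφ : ∀ z ∈ φ.source, ∀ v, v ∈ c.kernel z ↔
      mfderiv 𝓘(ℝ, E) 𝓘(ℝ, P × Q) φ z v ∈ sndKernel P g' (φ z) := by
    intro z hz v
    obtain ⟨hz1, hz2⟩ := hφsource z hz
    have e1 : c.f a =ᶠ[𝓝 z] (g' ∘ Prod.snd) ∘ φ := by
      filter_upwards [φ.open_source.mem_nhds hz] with z' hz'
      obtain ⟨hz1', hz2'⟩ := hφsource z' hz'
      have h1 : g (e (φ z')) = g' (φ z').2 := hg' _ (e.map_target hz2')
      have h2 : e (φ z') = χ z' := e.right_inv hz2'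
      rw [h2] at h1
      simp only [g, χ.left_inv hz1'] at h1
      exact h1
    have hgd := hg'd _ (e.map_target hz2)
    have hD : HasFDerivAt (g' ∘ Prod.snd)
        ((fderiv ℝ g' (φ z).2).comp (ContinuousLinearMap.snd ℝ P Q)) (φ z) :=
      hgd.hasFDerivAt.comp (φ z) hasFDerivAt_snd
    have h1 := mfderiv_comp z hD.differentiableAt.mdifferentiableAt
      (hφ.mdifferentiable.mdifferentiableAt hz)
    rw [← e1.mfderiv_eq, mfderiv_eq_fderiv, hD.fderiv] at h1
    rw [c.mem_kernel (hUa z hz1 (hOsub (heO hz2)).1)]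
    have h2 := DFunLike.congr_fun h1 v
    exact iff_of_eq (congrArg (fun u : EuclideanSpace ℝ (Fin q) => u = 0) h2)
  -- The distribution in coordinates, read in one fixed vector space so that its values at different
  -- points can be compared.
  let D : P × Q → Submodule ℝ (P × Q) := fun p => generatedDistribution (sndKernel P g') p
  have hΔ : ∀ z ∈ φ.source, ∀ v, v ∈ c.distribution z ↔
      mfderiv 𝓘(ℝ, E) 𝓘(ℝ, P × Q) φ z v ∈ generatedDistribution (sndKernel P g') (φ z) := by
    intro z hz v
    rw [c.distribution_eq]
    exact hφ.mem_generatedDistribution_iff hz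
      (mem_of_superset (φ.open_source.mem_nhds hz) fun z' hz' => hKφ z' hz') v
  have hrank : ∀ z ∈ φ.source, Module.finrank ℝ (c.distribution z) =
      Module.finrank ℝ (D (φ z)) := by
    intro z hz
    have h1 : (c.distribution z).map (hφ.mdifferentiable.mfderiv hz).toLinearEquiv.toLinearMap =
        generatedDistribution (sndKernel P g') (φ z) := by
      ext u
      rw [Submodule.mem_map]
      constructor
      · rintro ⟨v, hv, rfl⟩
        exact (hΔ z hz v).1 hv
      · intro hu
        obtain ⟨v, rfl⟩ := (hφ.mdifferentiable.mfderiv hz).surjective u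
        exact ⟨v, (hΔ z hz v).2 hu, rfl⟩
    have h2 := LinearEquiv.finrank_map_eq (hφ.mdifferentiable.mfderiv hz).toLinearEquiv
      (c.distribution z)
    rw [← h2, h1]
    rfl
  refine ⟨⟨m, φ, hφ, ?_, ?_⟩, ⟨hx, hxe⟩⟩
  · intro z hz z' hz' h
    rw [hrank z hz, hrank z' hz']
    have : D (φ z) = D (φ z') := le_antisymm
      (fun v hv => mem_generatedDistribution_sndKernel_congr h hv)
      (fun v hv => mem_generatedDistribution_sndKernel_congr h.symm hv)
    rw [this]
  · intro z hz hzk v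
    rw [hΔ z hz]
    -- The first factor is always contained in `D`; where the rank is `k`, the dimensions agree.
    have h1 : LinearMap.range (LinearMap.inl ℝ P Q) = D (φ z) := by
      refine Submodule.eq_of_le_of_finrank_eq ?_ ?_
      · rintro _ ⟨t, rfl⟩
        exact inl_mem_generatedDistribution_sndKernel (φ z) t
      · rw [← hrank z hz, hzk, LinearMap.finrank_range_of_inj LinearMap.inl_injective]
        simp [P]
    rw [LinearMap.range_inl] at h1
    exact iff_of_eq (congrArg (fun S : Submodule ℝ (P × Q) =>
      (id (mfderiv 𝓘(ℝ, E) 𝓘(ℝ, P × Q) φ z v) : P × Q) ∈ S) h1.symm)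

end Foliated

/-! ### The leaf space -/

section LocallyConstant

variable {F : Type*} [NormedAddCommGroup F] [NormedSpace ℝ F] {N : Type*} [TopologicalSpace N]
  [ChartedSpace F N] [IsManifold 𝓘(ℝ, F) ∞ N]
  {G : Type*} [NormedAddCommGroup G] [NormedSpace ℝ G]

lemma eventually_eq_of_eventually_mfderiv_eq_zero {f : N → G} {p : N}
    (h : ∀ᶠ p' in 𝓝 p, MDifferentiableAt 𝓘(ℝ, F) 𝓘(ℝ, G) f p' ∧
      mfderiv 𝓘(ℝ, F) 𝓘(ℝ, G) f p' = 0) : ∀ᶠ p' in 𝓝 p, f p' = f p := by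
  let χ := chartAt F p
  have hp : p ∈ χ.source := mem_chart_source F p
  have hχ : χ.IsSmooth (E := F) (E' := F) := isSmooth_chartAt p
  have ht : Tendsto χ.symm (𝓝 (χ p)) (𝓝 p) := by
    have := χ.symm.continuousAt (χ.map_source hp)
    rwa [ContinuousAt, χ.left_inv hp] at this
  obtain ⟨r, hr, hb⟩ := Metric.eventually_nhds_iff_ball.1
    ((ht.eventually h).and (χ.open_target.mem_nhds (χ.map_source hp)))
  have key : ∀ t ∈ Metric.ball (χ p) r, HasFDerivAt (f ∘ χ.symm) (0 : F →L[ℝ] G) t := by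
    intro t htb
    obtain ⟨⟨h1, h2⟩, h3⟩ := hb t htb
    have h4 := h1.hasMFDerivAt.comp t
      (hχ.symm.mdifferentiable.mdifferentiableAt h3).hasMFDerivAt
    rw [h2] at h4
    refine hasMFDerivAt_iff_hasFDerivAt.1 ?_
    convert! h4 using 1
  filter_upwards [(χ.continuousAt hp).eventually (Metric.ball_mem_nhds (χ p) hr),
    χ.open_source.mem_nhds hp] with p' hp' hs
  have h5 := Metric.isOpen_ball.is_const_of_fderiv_eq_zero (𝕜 := ℝ)
    (convex_ball (χ p) r).isPreconnected
    (fun t ht => (key t ht).differentiableAt.differentiableWithinAt)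
    (fun t ht => (key t ht).fderiv) hp' (Metric.mem_ball_self hr)
  simpa [χ.left_inv hp, χ.left_inv hs] using h5

end LocallyConstant

/-! ### Maps tangent to the distribution, plaques and their compatibility -/

section LeafSpace

variable {n : ℕ} {M : Type u} [TopologicalSpace M] [ChartedSpace (EuclideanSpace ℝ (Fin n)) M]
  {Δ : TangentDistribution n M} {k : ℕ}

/-- `g` is smooth and tangent to `Δ` near `p`, and `Δ` has rank `k` along `g`. -/
def IsTangentMapAt {F : Type*} [NormedAddCommGroup F] [NormedSpace ℝ F] {N : Type*}
    [TopologicalSpace N] [ChartedSpace F N] (Δ : TangentDistribution n M) (k : ℕ) (g : N → M)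
    (p : N) : Prop :=
  ∀ᶠ p' in 𝓝 p, ContMDiffAt 𝓘(ℝ, F) (𝓡 n) ∞ g p' ∧
    (∀ v : TangentSpace 𝓘(ℝ, F) p', mfderiv 𝓘(ℝ, F) (𝓡 n) g p' v ∈ Δ (g p')) ∧
    Module.finrank ℝ (Δ (g p')) = k

namespace FoliatedChart

variable (C : FoliatedChart Δ k)

/-- Where the rank is `k`, `Δ` is the kernel of the differential of the transverse coordinate, so
this coordinate has zero derivative along a tangent map. The construction of the leaves rests on
this. -/
lemma eventually_snd_eq {F : Type*} [NormedAddCommGroup F] [NormedSpace ℝ F] {N : Type*}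
    [TopologicalSpace N] [ChartedSpace F N] [IsManifold 𝓘(ℝ, F) ∞ N] {g : N → M} {p : N}
    (hg : IsTangentMapAt (F := F) Δ k g p) (hp : g p ∈ C.φ.source) :
    ∀ᶠ p' in 𝓝 p, g p' ∈ C.φ.source ∧ (C.φ (g p')).2 = (C.φ (g p)).2 := by
  have hs := hg.self_of_nhds.1.continuousAt.eventually (C.φ.open_source.mem_nhds hp)
  refine hs.and (eventually_eq_of_eventually_mfderiv_eq_zero (F := F)
    (f := fun p' => (C.φ (g p')).2) ?_)
  filter_upwards [hg, hs] with p' ⟨h1, h2, h3⟩ hs'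
  have h4 := (C.isSmooth.mdifferentiable.mdifferentiableAt hs').hasMFDerivAt.comp p'
    (h1.mdifferentiableAt (by simp)).hasMFDerivAt
  have h5 := (ContinuousLinearMap.hasMFDerivAt (ContinuousLinearMap.snd ℝ
    (EuclideanSpace ℝ (Fin k)) (EuclideanSpace ℝ (Fin C.m)))).comp p' h4
  refine ⟨h5.mdifferentiableAt, h5.mfderiv.trans ?_⟩
  ext1 v
  exact (C.mem_iff _ hs' h3 _).1 (h2 v)

variable {C}

lemma contMDiffAt_symm_prodMk {t : EuclideanSpace ℝ (Fin k)} {w : EuclideanSpace ℝ (Fin C.m)}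
    (h : (t, w) ∈ C.φ.target) :
    ContMDiffAt (𝓡 k) (𝓡 n) ∞ (fun t => C.φ.symm (t, w)) t := by
  have h1 := C.isSmooth.contMDiffOn_symm.contMDiffAt (C.φ.open_target.mem_nhds h)
  have h2 : ContMDiffAt (𝓡 k) 𝓘(ℝ, EuclideanSpace ℝ (Fin k) × EuclideanSpace ℝ (Fin C.m)) ∞
      (fun t : EuclideanSpace ℝ (Fin k) => (t, w)) t :=
    contMDiffAt_iff_contDiffAt.2 (contDiffAt_id.prodMk contDiffAt_const)
  exact h1.comp t h2

/-- The rank depends on `w` only, so it is still `k` at nearby points of the slice, and there `Δ` is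
the kernel of the second component. -/
lemma isTangentMapAt_symm_prodMk {t : EuclideanSpace ℝ (Fin k)}
    {w : EuclideanSpace ℝ (Fin C.m)} (h : (t, w) ∈ C.φ.target)
    (hk : Module.finrank ℝ (Δ (C.φ.symm (t, w))) = k) :
    IsTangentMapAt (F := EuclideanSpace ℝ (Fin k)) Δ k (fun t => C.φ.symm (t, w)) t := by
  have hc : ContinuousAt (fun t : EuclideanSpace ℝ (Fin k) => (t, w)) t := by fun_prop
  have hev : ∀ᶠ t' in 𝓝 t, (t', w) ∈ C.φ.target := hc.eventually (C.φ.open_target.mem_nhds h)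
  refine (eventually_eventually_nhds.2 hev).mono fun t' hev' => ?_
  have ht' := hev'.self_of_nhds
  have hk' : Module.finrank ℝ (Δ (C.φ.symm (t', w))) = k := by
    refine (C.finrank_eq _ (C.φ.map_target ht') _ (C.φ.map_target h) ?_).trans hk
    rw [C.φ.right_inv ht', C.φ.right_inv h]
  refine ⟨contMDiffAt_symm_prodMk ht', fun v => ?_, hk'⟩
  refine (C.mem_iff _ (C.φ.map_target ht') hk' _).2 ?_
  have h4 := (C.isSmooth.mdifferentiable.mdifferentiableAt (C.φ.map_target ht')).hasMFDerivAt.comp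
    t' ((contMDiffAt_symm_prodMk ht').mdifferentiableAt (by simp)).hasMFDerivAt
  have h5 := (ContinuousLinearMap.hasMFDerivAt (ContinuousLinearMap.snd ℝ
    (EuclideanSpace ℝ (Fin k)) (EuclideanSpace ℝ (Fin C.m)))).comp t' h4
  have h6 : HasMFDerivAt (𝓡 k) (𝓡 C.m) (fun _ : EuclideanSpace ℝ (Fin k) => w) t' 0 :=
    hasMFDerivAt_const _ _
  have h7 := hasMFDerivAt_unique h5 (h6.congr_of_eventuallyEq (hev'.mono fun t'' h'' => by
    simp [C.φ.right_inv h'']))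
  exact DFunLike.congr_fun h7 v

end FoliatedChart

/-- `Δ` has foliated charts around every point. -/
class HasFoliatedCharts (Δ : TangentDistribution n M) : Prop where
  exists_chart : ∀ x, ∃ C : FoliatedChart Δ (Module.finrank ℝ (Δ x)), x ∈ C.φ.source

variable (Δ k) in
/-- The set of points where `Δ` has rank `k`, to be endowed with the leaf topology. -/
@[ext]
structure LeafSpace : Type u where
  /-- The inclusion of the leaf space in the manifold. -/
  incl : M
  finrank_incl : Module.finrank ℝ (Δ incl) = k

namespace LeafSpace

lemma incl_injective : Function.Injective (incl : LeafSpace Δ k → M) := fun _ _ => LeafSpace.ext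

lemma exists_foliatedChart [HasFoliatedCharts Δ] (z : LeafSpace Δ k) :
    ∃ C : FoliatedChart Δ k, z.incl ∈ C.φ.source := by
  obtain ⟨x, rfl⟩ := z
  exact HasFoliatedCharts.exists_chart x

open Classical in
/-- The plaque through `z₀` of a foliated chart. -/
noncomputable def plaque (C : FoliatedChart Δ k) (z₀ : LeafSpace Δ k)
    (h₀ : z₀.incl ∈ C.φ.source) : PartialEquiv (LeafSpace Δ k) (EuclideanSpace ℝ (Fin k)) where
  toFun z := (C.φ z.incl).1
  invFun t :=
    if h : (t, (C.φ z₀.incl).2) ∈ C.φ.target then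
      ⟨C.φ.symm (t, (C.φ z₀.incl).2), by
        rw [C.finrank_eq _ (C.φ.map_target h) _ h₀ (by rw [C.φ.right_inv h]), z₀.finrank_incl]⟩
    -- A default value, irrelevant off the target.
    else z₀
  source := {z | z.incl ∈ C.φ.source ∧ (C.φ z.incl).2 = (C.φ z₀.incl).2}
  target := {t | (t, (C.φ z₀.incl).2) ∈ C.φ.target}
  map_source' z hz := by
    have h : ((C.φ z.incl).1, (C.φ z₀.incl).2) = C.φ z.incl := Prod.ext rfl hz.2.symm
    show ((C.φ z.incl).1, (C.φ z₀.incl).2) ∈ C.φ.target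
    rw [h]
    exact C.φ.map_source hz.1
  map_target' t ht := by
    have h : (t, (C.φ z₀.incl).2) ∈ C.φ.target := ht
    rw [dif_pos h]
    exact ⟨C.φ.map_target h, by simp only [C.φ.right_inv h]⟩
  left_inv' z hz := by
    have h : ((C.φ z.incl).1, (C.φ z₀.incl).2) = C.φ z.incl := Prod.ext rfl hz.2.symm
    have h' : ((C.φ z.incl).1, (C.φ z₀.incl).2) ∈ C.φ.target := by
      rw [h]; exact C.φ.map_source hz.1
    rw [dif_pos h']
    exact LeafSpace.ext ((congrArg C.φ.symm h).trans (C.φ.left_inv hz.1))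
  right_inv' t ht := by
    have h : (t, (C.φ z₀.incl).2) ∈ C.φ.target := ht
    rw [dif_pos h]
    simp only [C.φ.right_inv h]

section Plaque

variable {C : FoliatedChart Δ k} {z₀ : LeafSpace Δ k} {h₀ : z₀.incl ∈ C.φ.source}

lemma incl_plaque_symm {t : EuclideanSpace ℝ (Fin k)} (h : t ∈ (plaque C z₀ h₀).target) :
    ((plaque C z₀ h₀).symm t).incl = C.φ.symm (t, (C.φ z₀.incl).2) := by
  have h' : (t, (C.φ z₀.incl).2) ∈ C.φ.target := h
  exact congrArg incl (dif_pos h')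

lemma isOpen_plaque_target : IsOpen (plaque C z₀ h₀).target :=
  C.φ.open_target.preimage (Continuous.prodMk_left _)

lemma isTangentMapAt_plaque_symm {t : EuclideanSpace ℝ (Fin k)}
    (h : t ∈ (plaque C z₀ h₀).target) : IsTangentMapAt (F := EuclideanSpace ℝ (Fin k)) Δ k
      (fun t => C.φ.symm (t, (C.φ z₀.incl).2)) t := by
  refine FoliatedChart.isTangentMapAt_symm_prodMk h ?_
  rw [← incl_plaque_symm h]
  exact finrank_incl _

variable {C' : FoliatedChart Δ k} {z₀' : LeafSpace Δ k} {h₀' : z₀'.incl ∈ C'.φ.source}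

/-- The inverse of a plaque is tangent to `Δ`, so the transverse coordinate of `C'` is locally
constant along it: a plaque of `C` that meets a plaque of `C'` stays in it nearby. -/
lemma isOpen_plaque_symm_trans_source :
    IsOpen ((plaque C z₀ h₀).symm.trans (plaque C' z₀' h₀')).source := by
  rw [isOpen_iff_mem_nhds]
  rintro t ⟨ht, hs, hw⟩
  rw [PartialEquiv.symm_symm, incl_plaque_symm ht] at hs hw
  filter_upwards [(isOpen_plaque_target (h₀ := h₀)).mem_nhds ht,
    C'.eventually_snd_eq (isTangentMapAt_plaque_symm (h₀ := h₀) ht) hs] with t' ht' ⟨h1, h2⟩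
  refine ⟨ht', ?_⟩
  show _ ∧ _
  rw [PartialEquiv.symm_symm, incl_plaque_symm ht']
  exact ⟨h1, h2.trans hw⟩

lemma contDiffOn_plaque_symm_trans :
    ContDiffOn ℝ ∞ ((plaque C z₀ h₀).symm.trans (plaque C' z₀' h₀'))
      ((plaque C z₀ h₀).symm.trans (plaque C' z₀' h₀')).source := by
  rintro t ⟨ht, hs, hw⟩
  rw [PartialEquiv.symm_symm, incl_plaque_symm ht] at hs
  have h1 : ContMDiffAt (𝓡 k) (𝓡 k) ∞
      (fun t => (C'.φ (C.φ.symm (t, (C.φ z₀.incl).2))).1) t :=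
    (ContMDiff.contMDiffAt (ContinuousLinearMap.contMDiff (ContinuousLinearMap.fst ℝ
      (EuclideanSpace ℝ (Fin k)) (EuclideanSpace ℝ (Fin C'.m))))).comp t
    ((C'.isSmooth.contMDiffOn.contMDiffAt (C'.φ.open_source.mem_nhds hs)).comp t
      (FoliatedChart.contMDiffAt_symm_prodMk ht))
  refine ((contMDiffAt_iff_contDiffAt.1 h1).congr_of_eventuallyEq ?_).contDiffWithinAt
  filter_upwards [(isOpen_plaque_target (h₀ := h₀)).mem_nhds ht] with t' ht'
  exact congrArg (fun x => (C'.φ x).1) (incl_plaque_symm ht')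

end Plaque

end LeafSpace
end LeafSpace

/-! ### The manifold structure of the leaf space and its immersion -/

section LeafSpace

variable {n : ℕ} {M : Type u} [TopologicalSpace M] [ChartedSpace (EuclideanSpace ℝ (Fin n)) M]
  {Δ : TangentDistribution n M} {k : ℕ}

namespace LeafSpace

variable [HasFoliatedCharts Δ]

/-- A foliated chart around a point of the leaf space. -/
noncomputable def foliatedChartAt (z : LeafSpace Δ k) : FoliatedChart Δ k :=
  z.exists_foliatedChart.choose

lemma incl_mem_foliatedChartAt_source (z : LeafSpace Δ k) : z.incl ∈ z.foliatedChartAt.φ.source :=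
  z.exists_foliatedChart.choose_spec

variable (Δ k) in
/-- The plaques as charts of the leaf space. -/
noncomputable def chartedSpaceCore :
    ChartedSpaceCore (EuclideanSpace ℝ (Fin k)) (LeafSpace Δ k) where
  atlas := {e | ∃ C z₀ h₀, e = plaque C z₀ h₀}
  chartAt z := plaque z.foliatedChartAt z z.incl_mem_foliatedChartAt_source
  mem_chart_source z := ⟨z.incl_mem_foliatedChartAt_source, rfl⟩
  chart_mem_atlas _ := ⟨_, _, _, rfl⟩
  open_source := by
    rintro _ _ ⟨C, z₀, h₀, rfl⟩ ⟨C', z₀', h₀', rfl⟩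
    exact isOpen_plaque_symm_trans_source
  continuousOn_toFun := by
    rintro _ _ ⟨C, z₀, h₀, rfl⟩ ⟨C', z₀', h₀', rfl⟩
    exact contDiffOn_plaque_symm_trans.continuousOn

/-- The leaf topology, in which plaques are open. It is in general strictly finer than the topology
induced from `M`. -/
noncomputable instance : TopologicalSpace (LeafSpace Δ k) :=
  (chartedSpaceCore Δ k).toTopologicalSpace

noncomputable instance : ChartedSpace (EuclideanSpace ℝ (Fin k)) (LeafSpace Δ k) :=
  (chartedSpaceCore Δ k).toChartedSpace

lemma exists_eq_plaque {e : OpenPartialHomeomorph (LeafSpace Δ k) (EuclideanSpace ℝ (Fin k))}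
    (he : e ∈ atlas (EuclideanSpace ℝ (Fin k)) (LeafSpace Δ k)) :
    ∃ C z₀ h₀, e.toPartialEquiv = plaque C z₀ h₀ := by
  obtain ⟨_, ⟨e', rfl⟩, _, ⟨⟨C, z₀, h₀, rfl⟩, rfl⟩, rfl⟩ := he
  exact ⟨C, z₀, h₀, rfl⟩

instance : IsManifold (𝓡 k) ∞ (LeafSpace Δ k) := by
  refine isManifold_of_contDiffOn _ _ _ fun e e' he he' => ?_
  obtain ⟨C, z₀, h₀, h⟩ := exists_eq_plaque he
  obtain ⟨C', z₀', h₀', h'⟩ := exists_eq_plaque he'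
  have h1 := contDiffOn_plaque_symm_trans (C := C) (z₀ := z₀) (h₀ := h₀) (C' := C')
    (z₀' := z₀') (h₀' := h₀')
  rw [← h, ← h'] at h1
  simpa using! h1

section Chart

variable {z : LeafSpace Δ k} {t : EuclideanSpace ℝ (Fin k)}

lemma mem_chartAt_target : t ∈ (chartAt (EuclideanSpace ℝ (Fin k)) z).target ↔
    (t, (z.foliatedChartAt.φ z.incl).2) ∈ z.foliatedChartAt.φ.target := Iff.rfl

lemma incl_chartAt_symm (h : t ∈ (chartAt (EuclideanSpace ℝ (Fin k)) z).target) :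
    ((chartAt (EuclideanSpace ℝ (Fin k)) z).symm t).incl =
      z.foliatedChartAt.φ.symm (t, (z.foliatedChartAt.φ z.incl).2) :=
  incl_plaque_symm (h₀ := z.incl_mem_foliatedChartAt_source) h

end Chart

/-- Maps into the leaf space are smooth as soon as their composition with the inclusion is smooth
and tangent to `Δ`. -/
lemma contMDiffAt_of_incl_comp {F : Type*} [NormedAddCommGroup F] [NormedSpace ℝ F] {N : Type*}
    [TopologicalSpace N] [ChartedSpace F N] [IsManifold 𝓘(ℝ, F) ∞ N] {g : N → LeafSpace Δ k}
    {p : N} (hg : IsTangentMapAt (F := F) Δ k (incl ∘ g) p) :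
    ContMDiffAt 𝓘(ℝ, F) (𝓡 k) ∞ g p := by
  let C := (g p).foliatedChartAt
  let e := chartAt (EuclideanSpace ℝ (Fin k)) (g p)
  have hp : (incl ∘ g) p ∈ C.φ.source := (g p).incl_mem_foliatedChartAt_source
  have h1 : ContMDiffAt 𝓘(ℝ, F) (𝓡 k) ∞ (fun p' => e (g p')) p :=
    (ContMDiff.contMDiffAt (ContinuousLinearMap.contMDiff (ContinuousLinearMap.fst ℝ
      (EuclideanSpace ℝ (Fin k)) (EuclideanSpace ℝ (Fin C.m))))).comp p
    ((C.isSmooth.contMDiffOn.contMDiffAt (C.φ.open_source.mem_nhds hp)).comp p hg.self_of_nhds.1)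
  have h2 : ContMDiffAt (𝓡 k) (𝓡 k) ∞ e.symm (e (g p)) :=
    (contMDiffOn_chart_symm (x := g p)).contMDiffAt
      (e.open_target.mem_nhds (e.map_source (mem_chart_source _ (g p))))
  refine (h2.comp p h1).congr_of_eventuallyEq ?_
  -- Continuity of `g` for the leaf topology is not assumed: tangency alone keeps `g` in the plaque
  -- of `g p`, where the chart can be inverted.
  filter_upwards [C.eventually_snd_eq hg hp] with p' hp'
  exact (e.left_inv hp').symm

lemma contMDiff_incl : ContMDiff (𝓡 k) (𝓡 n) ∞ (incl : LeafSpace Δ k → M) := by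
  intro z
  let e := chartAt (EuclideanSpace ℝ (Fin k)) z
  have hz : z ∈ e.source := mem_chart_source _ z
  have h1 : ContMDiffAt (𝓡 k) (𝓡 k) ∞ e z :=
    (contMDiffOn_chart (x := z)).contMDiffAt (e.open_source.mem_nhds hz)
  have h2 := (FoliatedChart.contMDiffAt_symm_prodMk
    (mem_chartAt_target.1 (e.map_source hz))).comp z h1
  refine h2.congr_of_eventuallyEq ?_
  filter_upwards [e.open_source.mem_nhds hz] with z' hz'
  exact (congrArg incl (e.left_inv hz').symm).trans (incl_chartAt_symm (e.map_source hz'))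

instance [T2Space M] : T2Space (LeafSpace Δ k) :=
  T2Space.of_injective_continuous incl_injective contMDiff_incl.continuous

/-- The first component of the foliated chart, composed with the inclusion, is the plaque chart,
whose differential is invertible. -/
lemma mfderiv_incl_injective (z : LeafSpace Δ k) :
    Function.Injective (mfderiv (𝓡 k) (𝓡 n) (incl : LeafSpace Δ k → M) z) := by
  let C := z.foliatedChartAt
  let e := chartAt (EuclideanSpace ℝ (Fin k)) z
  have hz : z ∈ e.source := mem_chart_source _ z
  have he : e.IsSmooth (E := EuclideanSpace ℝ (Fin k)) (E' := EuclideanSpace ℝ (Fin k)) :=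
    isSmooth_chartAt z
  have h1 := (ContinuousLinearMap.hasMFDerivAt (ContinuousLinearMap.fst ℝ
    (EuclideanSpace ℝ (Fin k)) (EuclideanSpace ℝ (Fin C.m)))).comp z
    ((C.isSmooth.mdifferentiable.mdifferentiableAt z.incl_mem_foliatedChartAt_source).hasMFDerivAt.comp
      z ((contMDiff_incl z).mdifferentiableAt (by simp)).hasMFDerivAt)
  have h2 := hasMFDerivAt_unique h1 (he.mdifferentiable.mdifferentiableAt hz).hasMFDerivAt
  intro v v' hv
  refine (he.mdifferentiable.mfderiv hz).injective ?_
  show mfderiv (𝓡 k) (𝓡 k) e z v = mfderiv (𝓡 k) (𝓡 k) e z v'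
  rw [← h2]
  exact congrArg (fun u => (mfderiv (𝓡 n) 𝓘(ℝ, EuclideanSpace ℝ (Fin k) ×
    EuclideanSpace ℝ (Fin C.m)) C.φ z.incl u).1) hv

/-- The transverse coordinate is constant on the plaque, so the range lies in `Δ`; both have
dimension `k`. -/
lemma range_mfderiv_incl (z : LeafSpace Δ k) :
    (mfderiv (𝓡 k) (𝓡 n) (incl : LeafSpace Δ k → M) z).toLinearMap.range = Δ z.incl := by
  let C := z.foliatedChartAt
  let e := chartAt (EuclideanSpace ℝ (Fin k)) z
  have hz : z ∈ e.source := mem_chart_source _ z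
  have h1 := (ContinuousLinearMap.hasMFDerivAt (ContinuousLinearMap.snd ℝ
    (EuclideanSpace ℝ (Fin k)) (EuclideanSpace ℝ (Fin C.m)))).comp z
    ((C.isSmooth.mdifferentiable.mdifferentiableAt z.incl_mem_foliatedChartAt_source).hasMFDerivAt.comp
      z ((contMDiff_incl z).mdifferentiableAt (by simp)).hasMFDerivAt)
  have h2 : HasMFDerivAt (𝓡 k) (𝓡 C.m) (fun _ : LeafSpace Δ k => (C.φ z.incl).2) z 0 :=
    hasMFDerivAt_const _ _
  have h3 := hasMFDerivAt_unique h1 (h2.congr_of_eventuallyEq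
    (mem_of_superset (e.open_source.mem_nhds hz) fun z' hz' => hz'.2))
  have h4 : (mfderiv (𝓡 k) (𝓡 n) (incl : LeafSpace Δ k → M) z).toLinearMap.range ≤ Δ z.incl := by
    rintro _ ⟨v, rfl⟩
    exact (C.mem_iff _ z.incl_mem_foliatedChartAt_source z.finrank_incl _).2
      (DFunLike.congr_fun h3 v)
  have : FiniteDimensional ℝ (TangentSpace (𝓡 n) z.incl) :=
    inferInstanceAs (FiniteDimensional ℝ (EuclideanSpace ℝ (Fin n)))
  refine Submodule.eq_of_le_of_finrank_eq h4 ?_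
  rw [z.finrank_incl]
  refine (LinearMap.finrank_range_of_inj (mfderiv_incl_injective z)).trans ?_
  exact finrank_euclideanSpace_fin

lemma isTangentMapAt_incl (z : LeafSpace Δ k) :
    IsTangentMapAt (F := EuclideanSpace ℝ (Fin k)) Δ k (incl : LeafSpace Δ k → M) z :=
  Eventually.of_forall fun z' => ⟨contMDiff_incl z', fun v => by
    rw [← range_mfderiv_incl z']; exact ⟨v, rfl⟩, z'.finrank_incl⟩

end LeafSpace
end LeafSpace

/-! ### Countable subcovers of connected sets -/

section CountableCover

variable {X : Type*} [TopologicalSpace X]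

/-- If every member of an open cover meets only countably many others, then preconnected sets are
covered by countably many members. -/
lemma IsPreconnected.exists_countable_subcover {I : Type*} {P : I → Set X}
    (ho : ∀ i, IsOpen (P i)) (hcov : ∀ x, ∃ i, x ∈ P i)
    (hc : ∀ i, {j | (P i ∩ P j).Nonempty}.Countable) {s : Set X} (hs : IsPreconnected s) :
    ∃ S : Set I, S.Countable ∧ s ⊆ ⋃ i ∈ S, P i := by
  obtain rfl | ⟨x, hx⟩ := s.eq_empty_or_nonempty
  · exact ⟨∅, countable_empty, empty_subset _⟩
  obtain ⟨i₀, hi₀⟩ := hcov x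
  -- `T m` consists of the members reached from `i₀` by a chain of `m` successively intersecting
  -- members.
  let T : ℕ → Set I := fun m => m.rec {i₀} fun _ A => ⋃ i ∈ A, {j | (P i ∩ P j).Nonempty}
  have hT : ∀ m, (T m).Countable := fun m => by
    induction m with
    | zero => exact countable_singleton i₀
    | succ m ih => exact ih.biUnion fun i _ => hc i
  refine ⟨⋃ m, T m, countable_iUnion hT, ?_⟩
  have hopen : IsOpen (⋃ i ∈ ⋃ m, T m, P i) := isOpen_biUnion fun i _ => ho i
  -- The union of all reachable members is also closed: a member that meets it is reachable by one
  -- more link.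
  refine hs.subset_isClopen ⟨⟨?_⟩, hopen⟩ ⟨x, hx, mem_biUnion (mem_iUnion.2 ⟨0, rfl⟩) hi₀⟩
  rw [isOpen_iff_mem_nhds]
  intro y hy
  obtain ⟨j, hj⟩ := hcov y
  refine mem_of_superset ((ho j).mem_nhds hj) fun z hz hz' => hy ?_
  obtain ⟨i, hi, hzi⟩ := mem_iUnion₂.1 hz'
  obtain ⟨m, hm⟩ := mem_iUnion.1 hi
  exact mem_biUnion (mem_iUnion.2 ⟨m + 1, mem_biUnion hm ⟨z, hzi, hz⟩⟩) hj

lemma isLindelof_of_subset_of_secondCountable {s t : Set X} (hst : s ⊆ t)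
    [SecondCountableTopology t] : IsLindelof s := by
  have h := (HereditarilyLindelofSpace.isLindelof (X := t) (Subtype.val ⁻¹' s)).image
    continuous_subtype_val
  rwa [Subtype.image_preimage_coe, inter_eq_right.2 hst] at h

/-- In a paracompact manifold preconnected sets are Lindelöf. -/
lemma IsPreconnected.isLindelof_of_chartedSpace (H : Type*) [TopologicalSpace H]
    [SecondCountableTopology H] [LocallyCompactSpace H] [ChartedSpace H X] [T2Space X]
    [ParacompactSpace X] {s : Set X} (hs : IsPreconnected s) : IsLindelof s := by
  have : LocallyCompactSpace X := ChartedSpace.locallyCompactSpace H X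
  choose K hK hKs hKc using fun x : X => local_compact_nhds
    ((chartAt H x).open_source.mem_nhds (mem_chart_source H x))
  -- A locally finite refinement by sets inside compact subsets of chart domains: each member meets
  -- only finitely many others.
  obtain ⟨V, hVo, hVc, hVf, hVK⟩ := precise_refinement (fun x => interior (K x))
    (fun _ => isOpen_interior) (iUnion_eq_univ_iff.2 fun x => ⟨x, mem_interior_iff_mem_nhds.2 (hK x)⟩)
  have hVK' : ∀ x, V x ⊆ K x := fun x => (hVK x).trans interior_subset
  obtain ⟨S, hS, hsS⟩ := hs.exists_countable_subcover hVo (iUnion_eq_univ_iff.1 hVc) fun x => by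
    refine ((hVf.finite_nonempty_inter_compact (hKc x)).subset ?_).countable
    rintro y ⟨z, hz, hz'⟩
    exact ⟨z, hz', hVK' x hz⟩
  have h : IsLindelof (⋃ x ∈ S, s ∩ V x) := hS.isLindelof_biUnion fun x _ => by
    have := (chartAt H x).secondCountableTopology_source
    exact isLindelof_of_subset_of_secondCountable
      ((inter_subset_right.trans (hVK' x)).trans (hKs x))
  rwa [← inter_iUnion₂, inter_eq_left.2 hsS] at h

end CountableCover

/-! ### Second countability of connected open sets of the leaf space -/

section LeafSpace

variable {n : ℕ} {M : Type u} [TopologicalSpace M] [ChartedSpace (EuclideanSpace ℝ (Fin n)) M]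
  {Δ : TangentDistribution n M} {k : ℕ}

namespace LeafSpace

variable [HasFoliatedCharts Δ]

lemma secondCountableTopology_plaque (C : FoliatedChart Δ k) (z₀ : LeafSpace Δ k)
    (h₀ : z₀.incl ∈ C.φ.source) : SecondCountableTopology (plaque C z₀ h₀).source :=
  ((chartedSpaceCore Δ k).openPartialHomeomorph (plaque C z₀ h₀)
    ⟨C, z₀, h₀, rfl⟩).secondCountableTopology_source

/-- Connected open sets of the leaf space are second countable. -/
lemma secondCountableTopology_of_isPreconnected [T2Space M] [ParacompactSpace M]
    (L : Opens (LeafSpace Δ k)) (hL : IsPreconnected (L : Set (LeafSpace Δ k))) :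
    SecondCountableTopology L := by
  have hD : ∀ x ∈ incl '' (L : Set (LeafSpace Δ k)), ∃ D : FoliatedChart Δ k, x ∈ D.φ.source := by
    rintro _ ⟨z, -, rfl⟩
    exact z.exists_foliatedChart
  choose D hD using hD
  -- The image of `L` is connected in the paracompact manifold `M`, hence Lindelöf, and countably
  -- many foliated charts cover it.
  obtain ⟨A, hA, hLA⟩ := ((hL.image _
    contMDiff_incl.continuous.continuousOn).isLindelof_of_chartedSpace
      (EuclideanSpace ℝ (Fin n))).elim_nhds_subcover' (fun x hx => (D x hx).φ.source)
    fun x hx => (D x hx).φ.open_source.mem_nhds (hD x hx)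
  let C : A → FoliatedChart Δ k := fun a => D a.1 a.1.2
  have hcover : ∀ z : L, ∃ a : A, z.1.incl ∈ (C a).φ.source := by
    intro z
    obtain ⟨a, ha, h⟩ := mem_iUnion₂.1 (hLA ⟨z.1, z.2, rfl⟩)
    exact ⟨⟨a, ha⟩, h⟩
  have : Countable A := hA.to_subtype
  -- All plaques of these charts within `L`: countably many charts, but possibly uncountably many
  -- values of the transverse coordinate.
  let P : (Σ a : A, EuclideanSpace ℝ (Fin (C a).m)) → Set L := fun i =>
    {z | z.1.incl ∈ (C i.1).φ.source ∧ ((C i.1).φ z.1.incl).2 = i.2}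
  have hPo : ∀ i, IsOpen (P i) := by
    rintro i
    rw [isOpen_iff_mem_nhds]
    rintro z ⟨hz, hw⟩
    filter_upwards [continuous_subtype_val.continuousAt.eventually
      ((C i.1).eventually_snd_eq (isTangentMapAt_incl z.1) hz)] with z' hz'
    exact ⟨hz'.1, hz'.2.trans hw⟩
  have hPc : ∀ i, SecondCountableTopology (P i) := by
    rintro i
    obtain h | ⟨z, hz⟩ := (P i).eq_empty_or_nonempty
    · rw [h]; infer_instance
    · have := secondCountableTopology_plaque (C i.1) z.1 hz.1
      exact ((IsEmbedding.subtypeVal.comp IsEmbedding.subtypeVal).codRestrict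
        (plaque (C i.1) z.1 hz.1).source
          fun z' => ⟨z'.2.1, z'.2.2.trans hz.2.symm⟩).secondCountableTopology
  have : PreconnectedSpace L := Subtype.preconnectedSpace hL
  obtain ⟨S, hS, hcov⟩ := isPreconnected_univ.exists_countable_subcover hPo
    (fun z => let ⟨a, ha⟩ := hcover z; ⟨⟨a, ((C a).φ z.1.incl).2⟩, ha, rfl⟩) fun i => by
      have := hPc i
      have h1 : ∀ a : A, {w | (P i ∩ P ⟨a, w⟩).Nonempty}.Countable := fun a => by
        -- Inside the second countable set `P i`, the traces of the plaques of one chart are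
        -- disjoint, open and nonempty, so there are countably many.
        refine PairwiseDisjoint.countable_of_isOpen (α := P i)
          (s := fun w => Subtype.val ⁻¹' P ⟨a, w⟩) ?_
          (fun w _ => (hPo ⟨a, w⟩).preimage continuous_subtype_val) ?_
        · intro w _ w' _ hne
          refine disjoint_left.2 fun z hz hz' => hne ?_
          exact hz.2.symm.trans hz'.2
        · rintro w ⟨z, hz, hz'⟩
          exact ⟨⟨z, hz⟩, hz'⟩
      refine (countable_iUnion fun a : A => (h1 a).image fun w =>
        (⟨a, w⟩ : Σ a : A, EuclideanSpace ℝ (Fin (C a).m))).mono ?_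
      rintro ⟨a, w⟩ h
      exact mem_iUnion.2 ⟨a, w, h, rfl⟩
  have : Countable S := hS.to_subtype
  exact secondCountableTopology_of_countable_cover (U := fun i : S => P i.1) (fun i => hPo i.1)
    (by rw [← univ_subset_iff, ← biUnion_eq_iUnion S (fun i _ => P i)]; exact hcov)

end LeafSpace
end LeafSpace

/-! ### Leaves -/

section Opens

variable {E : Type*} [NormedAddCommGroup E] [NormedSpace ℝ E] {M : Type*} [TopologicalSpace M]
  [ChartedSpace E M] [IsManifold 𝓘(ℝ, E) ∞ M]

omit [IsManifold 𝓘(ℝ, E) ∞ M] in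
lemma TopologicalSpace.Opens.isSmooth_openPartialHomeomorphSubtypeCoe (U : Opens M)
    (h : Nonempty U) :
    (U.openPartialHomeomorphSubtypeCoe h).IsSmooth (E := E) (E' := E) where
  contMDiffOn := contMDiff_subtype_val.contMDiffOn
  contMDiffOn_symm := by
    intro y hy
    rw [← ContMDiffWithinAt.subtypeVal_comp_iff]
    exact contMDiffWithinAt_id.congr
      (fun z hz => (U.openPartialHomeomorphSubtypeCoe h).right_inv hz)
      ((U.openPartialHomeomorphSubtypeCoe h).right_inv hy)

end Opens

/-! ### Leaves as maximal integral submanifolds -/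

section Leaf

variable {n : ℕ} {M : Type u} [TopologicalSpace M] [ChartedSpace (EuclideanSpace ℝ (Fin n)) M]
  [IsManifold (𝓡 n) ∞ M] {Δ : TangentDistribution n M} {k : ℕ}

namespace IntegralSubmanifold

omit [IsManifold (𝓡 n) ∞ M] in
lemma finrank_incl (T : IntegralSubmanifold Δ) (p : T.carrier) :
    Module.finrank ℝ (Δ (T.incl p)) = T.dim := by
  rw [← T.tangent_incl p]
  exact (LinearMap.finrank_range_of_inj (T.immersion_incl p)).trans finrank_euclideanSpace_fin

omit [IsManifold (𝓡 n) ∞ M] in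
lemma isTangentMapAt_incl (T : IntegralSubmanifold Δ) (p : T.carrier) :
    IsTangentMapAt (F := EuclideanSpace ℝ (Fin T.dim)) Δ T.dim T.incl p :=
  Eventually.of_forall fun p' => ⟨T.smooth_incl p', fun v => by
    rw [← T.tangent_incl p']; exact ⟨v, rfl⟩, T.finrank_incl p'⟩

omit [IsManifold (𝓡 n) ∞ M] in
lemma ContainedIn.trans {S T R : IntegralSubmanifold Δ} (h : S.ContainedIn T)
    (h' : T.ContainedIn R) : S.ContainedIn R := by
  obtain ⟨g, hg, hgi⟩ := h
  obtain ⟨g', hg', hgi'⟩ := h'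
  exact ⟨g' ∘ g, hg'.comp hg, by rw [← Function.comp_assoc, hgi', hgi]⟩

omit [IsManifold (𝓡 n) ∞ M] in
-- Injectivity of the two immersions forces the factoring maps to be inverse to each other.
lemma ContainedIn.exists_equiv {S T : IntegralSubmanifold Δ} (h : S.ContainedIn T)
    (h' : T.ContainedIn S) : ∃ e : S.carrier ≃ T.carrier, ContMDiff (𝓡 S.dim) (𝓡 T.dim) ∞ e ∧
      ContMDiff (𝓡 T.dim) (𝓡 S.dim) ∞ e.symm ∧ T.incl ∘ e = S.incl := by
  obtain ⟨g, hg, hgi⟩ := h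
  obtain ⟨g', hg', hgi'⟩ := h'
  refine ⟨⟨g, g', fun p => S.injective_incl ?_, fun p => T.injective_incl ?_⟩, hg, hg', hgi⟩
  · exact (congrFun hgi' (g p)).trans (congrFun hgi p)
  · exact (congrFun hgi (g' p)).trans (congrFun hgi' p)

end IntegralSubmanifold

variable [HasFoliatedCharts Δ]

namespace LeafSpace

omit [IsManifold (𝓡 n) ∞ M] in
lemma isOpen_connectedComponent (z : LeafSpace Δ k) : IsOpen (connectedComponent z) :=
  have := ChartedSpace.locallyConnectedSpace (EuclideanSpace ℝ (Fin k)) (LeafSpace Δ k)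
  _root_.isOpen_connectedComponent

/-- The connected component of a point in the leaf space, as an open set. -/
def component (z : LeafSpace Δ k) : Opens (LeafSpace Δ k) :=
  ⟨connectedComponent z, z.isOpen_connectedComponent⟩

instance (z : LeafSpace Δ k) : ConnectedSpace z.component :=
  Subtype.connectedSpace isConnected_connectedComponent

variable [T2Space M] [ParacompactSpace M]

instance (z : LeafSpace Δ k) : ParacompactSpace z.component := by
  have := secondCountableTopology_of_isPreconnected z.component isPreconnected_connectedComponent
  have := ChartedSpace.locallyCompactSpace (EuclideanSpace ℝ (Fin k)) z.component
  infer_instance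

/-- The leaf through a point of the leaf space. -/
noncomputable def leaf (z : LeafSpace Δ k) : IntegralSubmanifold Δ :=
  -- The inclusion of an open subset has invertible differential, so the immersion property and the
  -- tangent spaces restrict from the leaf space to the component.
  have key (p : z.component) : ∃ e : EuclideanSpace ℝ (Fin k) ≃L[ℝ] EuclideanSpace ℝ (Fin k),
      ∀ v, mfderiv (𝓡 k) (𝓡 n) (fun p : z.component => p.1.incl) p v =
        mfderiv (𝓡 k) (𝓡 n) (incl : LeafSpace Δ k → M) p.1 (e v) := by
    have hs := z.component.isSmooth_openPartialHomeomorphSubtypeCoe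
      (E := EuclideanSpace ℝ (Fin k)) ⟨p⟩
    refine ⟨hs.mdifferentiable.mfderiv (mem_univ p), fun v => ?_⟩
    exact DFunLike.congr_fun (mfderiv_comp p ((contMDiff_incl p.1).mdifferentiableAt (by simp))
      (hs.mdifferentiable.mdifferentiableAt (mem_univ p))) v
  { carrier := z.component
    dim := k
    incl := fun p => p.1.incl
    smooth_incl := contMDiff_incl.comp contMDiff_subtype_val
    injective_incl := incl_injective.comp Subtype.val_injective
    immersion_incl := fun p v w h => by
      obtain ⟨e, he⟩ := key p
      exact e.injective (mfderiv_incl_injective p.1 ((he v).symm.trans (h.trans (he w))))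
    tangent_incl := fun p => by
      obtain ⟨e, he⟩ := key p
      rw [← range_mfderiv_incl p.1]
      ext u
      constructor
      · rintro ⟨v, rfl⟩
        exact ⟨e v, (he v).symm⟩
      · rintro ⟨v, rfl⟩
        refine ⟨e.symm v, (he _).trans ?_⟩
        exact congrArg _ (e.apply_symm_apply v) }

omit [IsManifold (𝓡 n) ∞ M] in
lemma mem_range_incl_leaf (z : LeafSpace Δ k) : z.incl ∈ range z.leaf.incl :=
  ⟨(⟨z, mem_connectedComponent⟩ : z.component), rfl⟩

omit [IsManifold (𝓡 n) ∞ M] in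
/-- Integral submanifolds are contained in every leaf they meet. -/
lemma containedIn_leaf (z : LeafSpace Δ k) {T : IntegralSubmanifold Δ}
    (h : z.incl ∈ range T.incl) : T.ContainedIn z.leaf := by
  obtain ⟨p, hp⟩ := h
  obtain rfl : T.dim = k := by rw [← z.finrank_incl, ← hp, T.finrank_incl p]
  -- `T` lies over the points of rank `T.dim`. Its lift to the leaf space is smooth by tangency, and
  -- its image is connected and contains `z`.
  let G : T.carrier → LeafSpace Δ T.dim := fun p => ⟨T.incl p, T.finrank_incl p⟩
  have hG : ContMDiff (𝓡 T.dim) (𝓡 T.dim) ∞ G := fun p' =>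
    contMDiffAt_of_incl_comp (T.isTangentMapAt_incl p')
  have hGp : G p = z := incl_injective hp
  have hmem : ∀ p', G p' ∈ z.component := fun p' =>
    (isPreconnected_range hG.continuous).subset_connectedComponent ⟨p, hGp⟩ ⟨p', rfl⟩
  have hG' : ContMDiff (𝓡 T.dim) (𝓡 T.dim) ∞ fun p' => (⟨G p', hmem p'⟩ : z.component) :=
    (ContMDiff.subtypeVal_comp_iff z.component fun p' => ⟨G p', hmem p'⟩).1 hG
  exact ⟨_, hG', rfl⟩

omit [IsManifold (𝓡 n) ∞ M] in
-- An integral submanifold that contains the leaf passes through `z`, so it is contained in the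
-- leaf.
lemma isMaximal_leaf (z : LeafSpace Δ k) : z.leaf.IsMaximal := by
  rintro T ⟨g, -, hg⟩
  refine z.containedIn_leaf ?_
  obtain ⟨p, hp⟩ := z.mem_range_incl_leaf
  exact ⟨g p, (congrFun hg p).trans hp⟩

end LeafSpace

variable [T2Space M] [ParacompactSpace M]

omit [IsManifold (𝓡 n) ∞ M] in
-- Both are contained in the leaf through a common point; by maximality that leaf is contained in
-- both, so each contains the other.
theorem IntegralSubmanifold.IsMaximal.exists_equiv {L L' : IntegralSubmanifold Δ}
    (hL : L.IsMaximal) (hL' : L'.IsMaximal) (h : (range L.incl ∩ range L'.incl).Nonempty) :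
    ∃ e : L.carrier ≃ L'.carrier, ContMDiff (𝓡 L.dim) (𝓡 L'.dim) ∞ e ∧
      ContMDiff (𝓡 L'.dim) (𝓡 L.dim) ∞ e.symm ∧ L'.incl ∘ e = L.incl := by
  obtain ⟨x, hx, hx'⟩ := h
  let z : LeafSpace Δ _ := ⟨x, rfl⟩
  have h1 := z.containedIn_leaf hx
  have h2 := z.containedIn_leaf hx'
  exact (h1.trans (hL' _ h2)).exists_equiv (h2.trans (hL _ h1))

omit [IsManifold (𝓡 n) ∞ M] in
variable (Δ) in
/-- A distribution with foliated charts defines a singular foliation. -/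
theorem definesSingularFoliation_of_hasFoliatedCharts : DefinesSingularFoliation Δ where
  exists_maximal x :=
    let z : LeafSpace Δ _ := ⟨x, rfl⟩
    ⟨z.leaf, z.isMaximal_leaf, z.mem_range_incl_leaf⟩
  unique_maximal L L' hL hL' h := hL.exists_equiv hL' h
  partition := by
    constructor
    · rintro ⟨L, -, hL⟩
      exact (range_nonempty L.incl).ne_empty hL
    · intro x
      let z : LeafSpace Δ _ := ⟨x, rfl⟩
      refine ⟨range z.leaf.incl, ⟨⟨z.leaf, z.isMaximal_leaf, rfl⟩, z.mem_range_incl_leaf⟩, ?_⟩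
      rintro _ ⟨⟨L, hL, rfl⟩, hx⟩
      obtain ⟨e, -, -, he⟩ := hL.exists_equiv z.isMaximal_leaf ⟨x, hx, z.mem_range_incl_leaf⟩
      rw [← he, e.surjective.range_comp]

end Leaf

instance HaefligerCocycle.hasFoliatedCharts_distribution {n q : ℕ} {M : Type u}
    [TopologicalSpace M] [ChartedSpace (EuclideanSpace ℝ (Fin n)) M] [IsManifold (𝓡 n) ∞ M]
    {ι : Type v} (c : HaefligerCocycle n q M ι) : HasFoliatedCharts c.distribution :=
  ⟨fun _ => c.exists_foliatedChart rfl⟩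

theorem mainTheorem11 {n q : ℕ} {M : Type u} [TopologicalSpace M]
    [ChartedSpace (EuclideanSpace ℝ (Fin n)) M] [IsManifold (𝓡 n) ∞ M] [T2Space M]
    [ParacompactSpace M] {ι : Type v} (c : HaefligerCocycle n q M ι) :
    IsTangentSubsheaf c.sheaf ∧
    IsInvolutiveSheaf c.sheaf ∧
    (∀ {ι' : Type w} (c' : HaefligerCocycle n q M ι'), c.Equivalent c' → c'.sheaf = c.sheaf) ∧
    IsFlowInvariant c.sheaf c.distribution ∧
    IsIntegrableDistribution c.distribution ∧
    DefinesSingularFoliation c.distribution :=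
  have h := definesSingularFoliation_of_hasFoliatedCharts c.distribution
  ⟨c.isTangentSubsheaf_sheaf, c.isInvolutiveSheaf_sheaf, fun _ hc => hc.sheaf_eq,
    c.isFlowInvariant_distribution,
    fun x => let ⟨L, _, hx⟩ := h.exists_maximal x; ⟨L, hx⟩, h⟩
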